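/- Let $a,u\in\mathbb R^2$ with $|u|=1$ and let $r_1>r_2>\cdots>0$ be reals with $r_n\to 0$. Let $C_n$ be the circle with centre $a+r_nu$ and radius $r_n$, and let $H=\bigcup_{n\ge1}C_n$ (a Hawaiian earring; for instance $a=0$, $u=(1,0)$, $r_n=1/n$). Let $C_n'$ and $H'$ be the images of $C_n$ and $H$ under the reflection in the line through $a$ orthogonal to $u$, which is the common tangent of the circles $C_n$ at $a$. Put $$Y=H\cup H'\subset\mathbb R^2,\qquad X=(H\times\{0\})\cup(H'\times\{1\})\cup(\{a\}\times[0,1])\subset\mathbb R^3,$$ and let $p:\mathbb R^3\to\mathbb R^2$, $p(x,y,z)=(x,y)$. A map $f:V\to W$ of topological spaces is called shy if it is continuous and $f^{-1}(A)$ is path-connected for every path-connected $A\subset f(V)$. A space $W$ is semilocally simply connected if every $w\in W$ has a neighbourhood $N$ such that every loop in $N$ is nullhomotopic in $W$. Then: 1. $H\cap H'=\{a\}$, and $p|_X:X\to Y$ is a shy surjection. 2. For no base point $x_0\in X$ is the induced homomorphism $(p|_X)_*:\pi_1(X,x_0)\to\pi_1(Y,p(x_0))$ surjective. 3. Write $D_0,D_1,D_2,D_3,\ldots$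 for the sequence $C_1,C_1',C_2,C_2',\ldots$, and let $m_0,m_1,\ldots$ be nonzero integers (for instance, all equal to $1$). Say that a loop $g:S^1\to Y$ winds around the circles in this order with winding numbers $m_k$ if there are $0=t_0<t_1<t_2<\cdots$ with $t_k\to1$ such that, for every $k$, $g(e^{2\pi i t_k})=a$ and $t\mapsto g(e^{2\pi i t})$, $t\in[t_k,t_{k+1}]$, is a loop in $D_k$ of winding number $m_k$ around the centre of $D_k$. Such loops $g$ exist, and for each such $g$ there is no loop $\ell:S^1\to X$ such that $p|_X\circ\ell$ is (freely) homotopic in $Y$ to $g$. 4. $Y$ is not semilocally simply connected. Hence the theorem that a shy surjection $F:X\to Y$ with $F(x_0)=y_0$ onto a semilocally simply connected space $Y$ induces a surjection $\pi_1(X,x_0)\to\pi_1(Y,y_0)$ fails without the hypothesis of semilocal simple connectivity. -/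

import Mathlib

open Set Filter Topology

noncomputable section

/-- A map is shy if it is continuous and the preimage of every path-connected subset of its image
is path-connected. (`IsPathConnected` includes non-emptiness, and the preimage of a non-empty
subset of the image is non-empty, so it does not matter whether `∅` counts as path-connected.) -/
def IsShy {X Y : Type*} [TopologicalSpace X] [TopologicalSpace Y] (f : X → Y) : Prop :=
  Continuous f ∧ ∀ A : Set Y, A ⊆ range f → IsPathConnected A → IsPathConnected (f ⁻¹' A)

/-- Every point has a neighbourhood `N` such that every loop in `N` is nullhomotopic in the whole
space. -/
def IsSemilocallySimplyConnected (X : Type*) [TopologicalSpace X] : Prop :=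
  ∀ x : X, ∃ N ∈ 𝓝 x, ∀ g : C(Circle, X), (∀ z, g z ∈ N) → g.Nullhomotopic

/-- The Euclidean plane `ℝ²`. -/
abbrev Plane : Type := EuclideanSpace ℝ (Fin 2)

/-- The data of a Hawaiian earring in the plane: the common point `a` of its circles, the unit
vector `u` pointing from `a` to the centres, and the radii, strictly decreasing to `0`. -/
structure HawaiianEarring where
  a : Plane
  u : Plane
  radius : ℕ → ℝ
  norm_u : ‖u‖ = 1
  radius_pos : ∀ n, 0 < radius n
  radius_strictAnti : StrictAnti radius
  radius_tendsto : Tendsto radius atTop (𝓝 0)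

namespace HawaiianEarring

variable (E : HawaiianEarring)

/-- The circles of `H`; index `n` gives the `(n + 1)`-st largest one. -/
def circle (n : ℕ) : Set Plane := Metric.sphere (E.a + E.radius n • E.u) (E.radius n)

/-- The Hawaiian earring `H`. -/
def H : Set Plane := ⋃ n, E.circle n

/-- The line through `a` that is tangent to the circles of `H`, that is, orthogonal to `u`. -/
def tangentLine : AffineSubspace ℝ Plane := AffineSubspace.mk' E.a (Submodule.span ℝ {E.u})ᗮ

instance : Nonempty E.tangentLine := ⟨⟨E.a, AffineSubspace.self_mem_mk' _ _⟩⟩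

instance : E.tangentLine.direction.HasOrthogonalProjection := by
  unfold tangentLine
  infer_instance

/-- The reflection of the plane in the tangent line. -/
def reflect : Plane → Plane := EuclideanGeometry.reflection E.tangentLine

/-- The circles of `H'`; index `n` gives the `(n + 1)`-st largest one. -/
def circle' (n : ℕ) : Set Plane := E.reflect '' E.circle n

/-- The reflected earring `H'`. -/
def H' : Set Plane := E.reflect '' E.H

/-- The planar space `Y = H ∪ H'`. -/
def Y : Set Plane := E.H ∪ E.H'

/-- The space `X = (H × {0}) ∪ (H' × {1}) ∪ ({a} × [0, 1])` in `ℝ³ = ℝ² × ℝ`. -/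
def X : Set (Plane × ℝ) := E.H ×ˢ {0} ∪ E.H' ×ˢ {1} ∪ {E.a} ×ˢ Icc 0 1

theorem a_mem_circle (n : ℕ) : E.a ∈ E.circle n := by
  simp [circle, norm_smul, E.norm_u, abs_of_pos (E.radius_pos n)]

theorem a_mem_Y : E.a ∈ E.Y := Or.inl (mem_iUnion.2 ⟨0, E.a_mem_circle 0⟩)

theorem fst_mem_Y {x : Plane × ℝ} (hx : x ∈ E.X) : x.1 ∈ E.Y := by
  rcases hx with (hx | hx) | hx
  · exact Or.inl hx.1
  · exact Or.inr hx.1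
  · rw [show x.1 = E.a from hx.1]
    exact E.a_mem_Y

/-- The restriction `X → Y` of the projection `ℝ² × ℝ → ℝ²`. -/
def proj : C(E.X, E.Y) where
  toFun x := ⟨x.1.1, E.fst_mem_Y x.2⟩
  continuous_toFun := by fun_prop

/-- The sequence of circles `C₁, C₁', C₂, C₂', C₃, C₃', …`. -/
def alternatingCircle (k : ℕ) : Set Plane :=
  if Even k then E.circle (k / 2) else E.circle' (k / 2)

end HawaiianEarring

/-- On the interval `[s, t]`, the curve `f` runs in the circle `D` and winds `m` times around it:
measured from the centre of `D`, it has a continuous angle that changes by `2πm`. -/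
def WindsAround (f : ℝ → Plane) (s t : ℝ) (D : Set Plane) (m : ℤ) : Prop :=
  ∃ (c : Plane) (ρ : ℝ) (θ : ℝ → ℝ), 0 < ρ ∧ D = Metric.sphere c ρ ∧
    ContinuousOn θ (Icc s t) ∧
    (∀ x ∈ Icc s t, f x = c + ρ • !₂[Real.cos (θ x), Real.sin (θ x)]) ∧
    θ t - θ s = 2 * Real.pi * m

namespace HawaiianEarring

/-- The loop `g : S¹ → Y`, read through `t ↦ e^{2πit}` on `[0, 1]`, winds around the circles
`C₁, C₁', C₂, C₂', …` in this order, each time starting and ending at `a`, with winding number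
`m k` around the `k`-th circle of the sequence (`k = 0, 1, 2, …`). -/
def WindsInAlternation (E : HawaiianEarring) (m : ℕ → ℤ) (g : C(Circle, E.Y)) : Prop :=
  ∃ t : ℕ → ℝ, t 0 = 0 ∧ StrictMono t ∧ Tendsto t atTop (𝓝 1) ∧
    ∀ k, (g (Circle.exp (2 * Real.pi * t k)) : Plane) = E.a ∧
      WindsAround (fun x => (g (Circle.exp (2 * Real.pi * x)) : Plane)) (t k) (t (k + 1))
        (E.alternatingCircle k) (m k)

end HawaiianEarring

end

/-! A loop in `X` can pass between the two earrings only along a segment of positive length. By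
compactness it does so finitely often, whereas a loop winding in alternation switches between `H`
and `H'` infinitely often. The proof turns this into a homotopy invariant.

For each `n`, collapsing the circles of index above `n` gives a continuous map `toWedge n` from `Y`
to a wedge of two circles, sending `H` to one and `H'` to the other. Over the wedge there is a
principal covering with structure group `SL₂(ℤ[X])`, whose monodromies are the elementary matrices
`1 + X E₁₂` and `1 + X E₂₁`. Free homotopies preserve holonomy up to conjugacy
(`HasHolonomy.isConj_of_homotopy`), hence the degree of its trace.

A winding around one circle contributes a power of one generator, whose entries have degree at most
`1` whatever the exponent; so the degree counts switches. For a loop winding in alternation, the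
trace has degree at least `2(n + 1)` (`hasHolonomy_of_windsInAlternation`,
`le_natDegree_trace_alternatingProduct`). For a loop coming from `X`, the degree is at most a number
`K` independent of `n` (`exists_degreeLE_hasHolonomy`). Taking `n = K` gives the contradiction.

Small circles of `H` have nontrivial holonomy for suitable `n`, so `Y` is not semilocally simply
connected. -/

noncomputable section

/-! ### Principal coverings of the wedge of two circles -/

/-- The wedge of two circles, as the union of the two coordinate circles in a torus. -/
def WedgeOfCircles : Set (Bool → ℂ) := {p | (∀ b, ‖p b‖ = 1) ∧ ∃ b, p b = 1}

namespace WedgeOfCircles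

variable {G : Type*} [Group G] (s : Bool → G)

/-- The comparison between the two charts of the covering with monodromy `s`: crossing the
lower half of the circle `b` costs a factor `(s b)⁻¹`. -/
def transition (p : Bool → ℂ) : G :=
  (if (p false).im < 0 then (s false)⁻¹ else 1) * (if (p true).im < 0 then (s true)⁻¹ else 1)

theorem transition_of_axis {p : Bool → ℂ} {b : Bool} (hp : p (!b) = 1) :
    transition s p = if (p b).im < 0 then (s b)⁻¹ else 1 := by
  cases b <;> simp_all [transition]

theorem exists_axis (w : WedgeOfCircles) : ∃ b, w.1 (!b) = 1 := by
  obtain ⟨b, hb⟩ := w.2.2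
  exact ⟨!b, by simpa using hb⟩

theorem im_ne_zero {z : ℂ} (hz : ‖z‖ = 1) (h1 : z ≠ 1) (h2 : z ≠ -1) : z.im ≠ 0 := by
  intro h
  have h3 : (z.re - 1) * (z.re + 1) = 0 := by
    have := Complex.sq_norm z
    rw [hz, Complex.normSq_apply, h] at this
    linarith
  rcases mul_eq_zero.1 h3 with h3 | h3
  · exact h1 (Complex.ext (by simp; linarith) (by simpa using h))
  · exact h2 (Complex.ext (by simp; linarith) (by simpa using h))

theorem continuous_coordinate (b : Bool) : Continuous fun w : WedgeOfCircles => w.1 b :=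
  (continuous_apply b).comp continuous_subtype_val

/-- The domains of the two charts. -/
def chartSource (i : Bool) : Set WedgeOfCircles :=
  bif i then {w | ∀ b, w.1 b ≠ -1} else {w | ∃ b, w.1 b ≠ 1}

/-- The factor relating the fibre coordinate in the chart `i` to the one in the chart `true`. -/
def chartFactor (i : Bool) (p : Bool → ℂ) : G := bif i then 1 else transition s p

theorem isOpen_chartSource (i : Bool) : IsOpen (chartSource i) := by
  cases i
  · simp only [chartSource, cond_false, ne_eq, ofPred_exists]
    exact isOpen_iUnion fun b => isOpen_ne_fun (continuous_coordinate b) continuous_const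
  · simp only [chartSource, cond_true, ne_eq, ofPred_forall]
    exact isOpen_iInter_of_finite fun b => isOpen_ne_fun (continuous_coordinate b) continuous_const

/-- A point in both charts has a single coordinate different from `1`, and that coordinate is not
real. Nearby points lie on the same open half of the same circle, so the cocycle is locally
constant. -/
theorem transition_eventuallyEq {w : WedgeOfCircles} (h0 : w ∈ chartSource false)
    (h1 : w ∈ chartSource true) :
    ∀ᶠ v : WedgeOfCircles in 𝓝 w, transition s v.1 = transition s w.1 := by
  obtain ⟨b, hb⟩ := exists_axis w
  have hwb : w.1 b ≠ 1 := by
    obtain ⟨c, hc⟩ := h0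
    cases b <;> cases c <;> simp_all
  have him := im_ne_zero (w.2.1 b) hwb (h1 b)
  have hcont : ContinuousAt (fun v : WedgeOfCircles => (v.1 b).im) w :=
    (Complex.continuous_im.comp (continuous_coordinate b)).continuousAt
  have hcont' : ContinuousAt (fun v : WedgeOfCircles => v.1 b) w :=
    (continuous_coordinate b).continuousAt
  have haxis : ∀ᶠ v : WedgeOfCircles in 𝓝 w, v.1 (!b) = 1 := by
    filter_upwards [hcont'.eventually_ne hwb] with v hv
    obtain ⟨c, hc⟩ := v.2.2
    cases b <;> cases c <;> simp_all
  rcases lt_or_gt_of_ne him with h | h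
  · filter_upwards [haxis, hcont.eventually_lt continuousAt_const h] with v hv hv'
    rw [transition_of_axis s hv, transition_of_axis s hb, if_pos h, if_pos hv']
  · filter_upwards [haxis, hcont.eventually_const_lt h] with v hv hv'
    rw [transition_of_axis s hv, transition_of_axis s hb, if_neg h.not_gt, if_neg hv'.not_gt]

variable [TopologicalSpace G] [DiscreteTopology G]

open Classical in
/-- The gluing data of the principal covering of the wedge with monodromy `s`. -/
def coverCore : FiberBundleCore Bool WedgeOfCircles G where
  baseSet := chartSource
  isOpen_baseSet := isOpen_chartSource
  indexAt w := decide (w ∈ chartSource true)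
  mem_baseSet_at w := by
    by_cases h : w ∈ chartSource true
    · simp only [h, decide_true]
    · simp only [h, decide_false]
      by_contra h'
      refine h fun b hb => h' ⟨b, ?_⟩
      rw [hb]
      norm_num
  coordChange i j w v := chartFactor s j w.1 * (chartFactor s i w.1)⁻¹ * v
  coordChange_self i w _ v := by simp
  continuousOn_coordChange i j := by
    rintro ⟨w, g⟩ ⟨⟨hi, hj⟩, -⟩
    have hloc : ∀ᶠ p : WedgeOfCircles × G in 𝓝 (w, g),
        chartFactor s j p.1.1 * (chartFactor s i p.1.1)⁻¹ * p.2 =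
          chartFactor s j w.1 * (chartFactor s i w.1)⁻¹ * g := by
      have h2 : ∀ᶠ p : WedgeOfCircles × G in 𝓝 (w, g), p.2 = g :=
        (continuousAt_snd (p := (w, g))).eventually_mem (show {g} ∈ 𝓝 g by simp)
      have h1 : i ≠ j → ∀ᶠ p : WedgeOfCircles × G in 𝓝 (w, g),
          transition s p.1.1 = transition s w.1 := fun hij => by
        refine (continuousAt_fst (p := (w, g))).eventually
          (p := fun v => transition s v.1 = transition s w.1) ?_
        cases i <;> cases j
        · exact absurd rfl hij
        · exact transition_eventuallyEq s hi hj
        · exact transition_eventuallyEq s hj hi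
        · exact absurd rfl hij
      by_cases hij : i = j
      · subst hij
        filter_upwards [h2] with p hp
        simp [hp]
      · filter_upwards [h1 hij, h2] with p hp hp'
        cases i <;> cases j <;> simp [chartFactor, hp, hp']
    exact (continuousAt_const.congr (hloc.mono fun _ h => h.symm)).continuousWithinAt
  coordChange_comp i j k w _ v := by group

/-- The total space of the principal covering of the wedge with monodromy `s`. -/
abbrev Cover : Type _ := (coverCore s).TotalSpace

namespace Cover

variable {s}

/-- The fibre coordinate in the chart `true`, extended to all points. -/
def coord (z : Cover s) : G :=
  (chartFactor s ((coverCore s).indexAt z.1) z.1.1)⁻¹ * (show G from z.2)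

variable (s) in
/-- The point of the covering with given projection and fibre coordinate. -/
def mk (w : WedgeOfCircles) (g : G) : Cover s :=
  ⟨w, chartFactor s ((coverCore s).indexAt w) w.1 * g⟩

@[simp] theorem proj_mk (w : WedgeOfCircles) (g : G) : (mk s w g).1 = w := rfl

@[simp] theorem coord_mk (w : WedgeOfCircles) (g : G) : coord (mk s w g) = g := by
  simp [coord, mk]

theorem mk_coord (z : Cover s) : mk s z.1 (coord z) = z := by
  refine congrArg (Bundle.TotalSpace.mk z.1) ?_
  exact mul_inv_cancel_left (chartFactor s _ z.1.1) (show G from z.2)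

theorem ext {z z' : Cover s} (h : z.1 = z'.1) (h' : coord z = coord z') : z = z' := by
  rw [← mk_coord z, ← mk_coord z', h, h']

/-- The fibre is discrete, so its chart coordinate must be eventually constant. The factor is needed
because `coord` itself may jump where the chart `true` is not available. -/
theorem tendsto_iff {α : Type*} {f : α → Cover s} {l : Filter α} {z : Cover s} {i : Bool}
    (hz : z.1 ∈ chartSource i) :
    Tendsto f l (𝓝 z) ↔ Tendsto (fun t => (f t).1) l (𝓝 z.1) ∧
      ∀ᶠ t in l, chartFactor s i (f t).1.1 * coord (f t) = chartFactor s i z.1.1 * coord z := by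
  have h : ∀ z : Cover s, ((coverCore s).localTriv i z).2 = chartFactor s i z.1.1 * coord z :=
    fun z => mul_assoc _ _ _
  rw [((coverCore s).localTriv i).tendsto_nhds_iff (by exact hz)]
  simp only [h, nhds_discrete, tendsto_pure]
  rfl

variable (s) in
theorem isCoveringMap_proj : IsCoveringMap (coverCore s).proj :=
  FiberBundle.isCoveringMap

/-- Right translation on the covering. -/
def rightMul (c : G) (z : Cover s) : Cover s := mk s z.1 (coord z * c)

@[simp] theorem proj_rightMul (c : G) (z : Cover s) : (rightMul c z).1 = z.1 := rfl

@[simp] theorem coord_rightMul (c : G) (z : Cover s) : coord (rightMul c z) = coord z * c :=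
  coord_mk _ _

/-- The charts are glued by left multiplications, which commute with right translation. -/
theorem continuous_rightMul (c : G) : Continuous (rightMul (s := s) c) := by
  refine continuous_iff_continuousAt.2 fun z => ?_
  have hz : z.1 ∈ chartSource ((coverCore s).indexAt z.1) := (coverCore s).mem_baseSet_at z.1
  obtain ⟨h1, h2⟩ := (tendsto_iff hz).1 (tendsto_id (x := 𝓝 z))
  refine (tendsto_iff (by exact hz)).2 ⟨h1, ?_⟩
  filter_upwards [h2] with t ht
  simp only [proj_rightMul, coord_rightMul, ← mul_assoc]
  rw [show chartFactor s _ t.1.1 * coord t = _ from ht]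

/-- If the transition values along a curve lie in a subgroup, then the fibre coordinate along a
lift of the curve stays in one coset. -/
theorem coord_mul_inv_mem {T : Type*} [TopologicalSpace T] {S : Set T} (hS : IsPreconnected S)
    {Γ : T → Cover s} (hΓ : ContinuousOn Γ S) {A : Subgroup G}
    (hA : ∀ t ∈ S, transition s (Γ t).1.1 ∈ A) {t t' : T} (ht : t ∈ S) (ht' : t' ∈ S) :
    coord (Γ t') * (coord (Γ t))⁻¹ ∈ A := by
  have hfac : ∀ i, ∀ t ∈ S, chartFactor s i (Γ t).1.1 ∈ A := by
    rintro (_ | _) t ht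
    · exact hA t ht
    · exact A.one_mem
  -- On a preconnected set it suffices to compare nearby times. There the chart factor times `coord`
  -- is constant, so the two values of `coord` differ by a product of chart factors, which lie in
  -- `A`.
  refine hS.induction₂ (fun t t' => coord (Γ t') * (coord (Γ t))⁻¹ ∈ A) ?_ ?_ ?_ ht ht'
  · intro t ht
    have hz := (coverCore s).mem_baseSet_at (Γ t).1
    filter_upwards [((tendsto_iff hz).1 (hΓ t ht)).2, self_mem_nhdsWithin] with t' h ht'
    rw [eq_inv_mul_of_mul_eq h]
    simpa [mul_assoc] using A.mul_mem (A.inv_mem (hfac _ t' ht')) (hfac _ t ht)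
  · intro a b c _ _ _ h h'
    simpa [mul_assoc] using A.mul_mem h' h
  · intro a b _ _ h
    simpa using A.inv_mem h

end Cover
end WedgeOfCircles
end

/-! ### Holonomy and its invariance under free homotopy -/

noncomputable section
namespace WedgeOfCircles

open scoped unitInterval

variable {G : Type*} [Group G] {s : Bool → G}

/-- The point at angle `θ` on the circle `b` of the wedge. -/
def circlePoint (b : Bool) (θ : ℝ) : WedgeOfCircles :=
  ⟨Function.update 1 b (Complex.exp (θ * Complex.I)), by
    constructor
    · intro c
      by_cases h : c = b
      · subst h
        simp [Complex.norm_exp_ofReal_mul_I]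
      · simp [h]
    · exact ⟨!b, by simp⟩⟩

theorem circlePoint_apply_self (b : Bool) (θ : ℝ) :
    (circlePoint b θ).1 b = Complex.exp (θ * Complex.I) := by
  simp [circlePoint]

theorem circlePoint_apply_not (b : Bool) (θ : ℝ) : (circlePoint b θ).1 (!b) = 1 := by
  simp [circlePoint]

theorem continuous_circlePoint (b : Bool) : Continuous (circlePoint b) := by
  refine Continuous.subtype_mk (continuous_const.update b ?_) _
  fun_prop

theorem transition_circlePoint (b : Bool) (θ : ℝ) :
    transition s (circlePoint b θ).1 = if Real.sin θ < 0 then (s b)⁻¹ else 1 := by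
  rw [transition_of_axis s (circlePoint_apply_not b θ), circlePoint_apply_self,
    Complex.exp_ofReal_mul_I_im]

variable [TopologicalSpace G] [DiscreteTopology G]

variable (s) in
/-- Along some lift of the curve `γ` the fibre coordinate gets multiplied by `M`. -/
def HasHolonomy (γ : C(I, WedgeOfCircles)) (M : G) : Prop :=
  ∃ Γ : C(I, Cover s), (∀ t, (Γ t).1 = γ t) ∧ Cover.coord (Γ 1) = M * Cover.coord (Γ 0)

/-- Right translation is a deck transformation, so uniqueness of lifts applies once the two lifts
agree at one point. -/
theorem Cover.eq_rightMul {T : Type*} [TopologicalSpace T] [PreconnectedSpace T]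
    {Γ Γ' : T → Cover s} (hΓ : Continuous Γ) (hΓ' : Continuous Γ') (h : ∀ t, (Γ t).1 = (Γ' t).1)
    {c : G} {t₀ : T} (h₀ : coord (Γ' t₀) = coord (Γ t₀) * c) (t : T) :
    Γ' t = rightMul c (Γ t) := by
  refine congrFun ((isCoveringMap_proj s).eq_of_comp_eq hΓ'
    ((continuous_rightMul c).comp hΓ) (funext fun t => (h t).symm) t₀ ?_) t
  exact Cover.ext (h t₀).symm (by simp [h₀])

theorem exists_lift (γ : C(I, WedgeOfCircles)) :
    ∃ Γ : C(I, Cover s), ∀ t, (Γ t).1 = γ t := by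
  obtain ⟨Γ, h, -⟩ := (Cover.isCoveringMap_proj s).exists_path_lifts γ (Cover.mk s (γ 0) 1) rfl
  exact ⟨Γ, congrFun h⟩

/-- Lift the homotopy. The sides `r ↦ h (r, 0)` and `r ↦ h (r, 1)` coincide in the base, so their
lifts differ by one right translation `c` for all `r`. At `r = 0` this `c` is a conjugate of `M₀`,
at `r = 1` a conjugate of `M₁`. -/
theorem HasHolonomy.isConj_of_homotopy {h : C(I × I, WedgeOfCircles)}
    (hloop : ∀ r, h (r, 0) = h (r, 1)) {γ₀ γ₁ : C(I, WedgeOfCircles)}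
    (h₀ : ∀ t, h (0, t) = γ₀ t) (h₁ : ∀ t, h (1, t) = γ₁ t) {M₀ M₁ : G}
    (hM₀ : HasHolonomy s γ₀ M₀) (hM₁ : HasHolonomy s γ₁ M₁) : IsConj M₀ M₁ := by
  obtain ⟨Γ₀, hΓ₀, hc₀⟩ := hM₀
  obtain ⟨Γ₁, hΓ₁, hc₁⟩ := hM₁
  have cov := Cover.isCoveringMap_proj s
  have H0 : ∀ a, h (0, a) = (coverCore s).proj (Γ₀ a) := fun a => (h₀ a).trans (hΓ₀ a).symm
  set K := cov.liftHomotopy h Γ₀ H0 with hK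
  have K_lifts : ∀ x, (K x).1 = h x := congrFun (cov.liftHomotopy_lifts h Γ₀ H0)
  have K_zero : ∀ a, K (0, a) = Γ₀ a := cov.liftHomotopy_zero h Γ₀ H0
  set c : G := (Cover.coord (Γ₀ 0))⁻¹ * M₀ * Cover.coord (Γ₀ 0) with hc
  have side := Cover.eq_rightMul (Γ := fun r : I => K (r, 0)) (Γ' := fun r : I => K (r, 1))
    (by fun_prop) (by fun_prop) (fun r => by rw [K_lifts, K_lifts, hloop]) (c := c) (t₀ := 0)
    (by rw [K_zero, K_zero, hc₀, hc]; group) 1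
  have top := Cover.eq_rightMul (Γ := fun t : I => K (1, t)) (Γ' := Γ₁)
    (by fun_prop) (by fun_prop) (fun r => by rw [K_lifts, h₁, hΓ₁])
    (c := (Cover.coord (K (1, 0)))⁻¹ * Cover.coord (Γ₁ 0)) (t₀ := 0) (by group) 1
  rw [top, side] at hc₁
  simp only [Cover.coord_rightMul] at hc₁
  have : M₁ = Cover.coord (K (1, 0)) * c * (Cover.coord (K (1, 0)))⁻¹ := by
    rw [← mul_left_inj (Cover.coord (Γ₁ 0)), ← hc₁]
    group
  rw [isConj_iff]
  refine ⟨Cover.coord (K (1, 0)) * (Cover.coord (Γ₀ 0))⁻¹, ?_⟩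
  rw [this, hc]
  group

/-- The lift to the covering of the universal covering `θ ↦ e ^ (iθ)` of the circle `b`. -/
def circleLift (s : Bool → G) (b : Bool) (g : G) (θ : ℝ) : Cover s :=
  Cover.mk s (circlePoint b θ) (s b ^ ⌈θ / (2 * Real.pi) - 1 / 2⌉ * g)

/-- The exponent of `s b` jumps only at odd multiples of `π`, where the circle point is `-1`. In the
chart `false` the jump is cancelled by the factor `(s b)⁻¹` acquired on entering the lower half.
Elsewhere the exponent is locally constant and the chart `true` serves. -/
theorem continuous_circleLift (b : Bool) (g : G) : Continuous (circleLift s b g) := by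
  refine continuous_iff_continuousAt.2 fun θ₀ => ?_
  have hpi := Real.pi_pos
  have hcont : ContinuousAt (fun θ => θ / (2 * Real.pi) - 1 / 2) θ₀ := by fun_prop
  have hproj := (continuous_circlePoint b).continuousAt (x := θ₀)
  have hθ : ∀ θ, θ = Real.pi + (θ / (2 * Real.pi) - 1 / 2) * (2 * Real.pi) := fun θ => by
    field_simp
    ring
  by_cases hn : ∃ n : ℤ, θ₀ / (2 * Real.pi) - 1 / 2 = n
  · obtain ⟨n, hn⟩ := hn
    -- The window is half a turn to either side of `-1`; it stops at the point `1`, where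
    -- `transition` jumps the other way.
    have hfac : ∀ θ, θ / (2 * Real.pi) - 1 / 2 ∈ Ioo (n - 1 / 2 : ℝ) (n + 1 / 2) →
        transition s (circlePoint b θ).1 * s b ^ ⌈θ / (2 * Real.pi) - 1 / 2⌉ = s b ^ n := by
      intro θ hv
      set v := θ / (2 * Real.pi) - 1 / 2 with hvdef
      have hsin : Real.sin θ = - Real.sin ((v - n) * (2 * Real.pi)) := by
        rw [hθ θ, ← hvdef, add_comm, Real.sin_add_pi, sub_mul v, Real.sin_sub_int_mul_two_pi]
      rw [transition_circlePoint, hsin]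
      rcases le_or_gt v n with h | h
      · have : Real.sin ((v - n) * (2 * Real.pi)) ≤ 0 :=
          Real.sin_nonpos_of_nonpos_of_neg_pi_le (by nlinarith) (by nlinarith [hv.1])
        rw [if_neg (by linarith), (Int.ceil_eq_iff (z := n)).2 ⟨by linarith [hv.1], h⟩, one_mul]
      · have : 0 < Real.sin ((v - n) * (2 * Real.pi)) :=
          Real.sin_pos_of_pos_of_lt_pi (by nlinarith) (by nlinarith [hv.2])
        rw [if_pos (by linarith), (Int.ceil_eq_iff (z := n + 1)).2
          ⟨by push_cast; linarith, by push_cast; linarith [hv.2]⟩, add_comm, zpow_one_add,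
          inv_mul_cancel_left]
    have hmem : circlePoint b θ₀ ∈ chartSource false := by
      refine ⟨b, fun h => ?_⟩
      rw [circlePoint_apply_self] at h
      have := congrArg Complex.re h
      rw [Complex.exp_ofReal_mul_I_re, hθ θ₀, hn, add_comm, Real.cos_add_pi,
        Real.cos_int_mul_two_pi] at this
      norm_num at this
    refine (Cover.tendsto_iff (i := false) hmem).2 ⟨hproj, ?_⟩
    have hself := hfac θ₀ (by rw [hn]; constructor <;> linarith)
    filter_upwards [hcont.eventually_mem (isOpen_Ioo.mem_nhds
      (show _ ∈ Ioo (n - 1 / 2 : ℝ) (n + 1 / 2) by rw [hn]; constructor <;> linarith))] with θ h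
    simp only [circleLift, Cover.coord_mk, Cover.proj_mk, chartFactor, cond_false, ← mul_assoc]
    rw [hfac θ h, hself]
  · have hmem : circlePoint b θ₀ ∈ chartSource true := by
      intro c h
      by_cases hc : c = b
      · subst hc
        rw [circlePoint_apply_self, ← Complex.exp_pi_mul_I, Complex.exp_eq_exp_iff_exists_int] at h
        obtain ⟨n, h⟩ := h
        refine hn ⟨n, ?_⟩
        have h' := congrArg Complex.im h
        simp only [Complex.add_im, Complex.mul_im, Complex.mul_re, Complex.ofReal_re,
          Complex.ofReal_im, Complex.I_re, Complex.I_im, Complex.intCast_re, Complex.intCast_im,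
          Complex.re_ofNat, Complex.im_ofNat] at h'
        ring_nf at h'
        rw [h']
        field_simp
        ring
      · have := circlePoint_apply_not b θ₀
        rw [Bool.eq_not.2 hc, this] at h
        norm_num at h
    refine (Cover.tendsto_iff (i := true) hmem).2 ⟨hproj, ?_⟩
    set v := θ₀ / (2 * Real.pi) - 1 / 2 with hv
    have hlt : v < ⌈v⌉ := lt_of_le_of_ne (Int.le_ceil v) fun h => hn ⟨_, h⟩
    have hgt : (⌈v⌉ : ℝ) - 1 < v := by linarith [Int.ceil_lt_add_one v]
    filter_upwards [hcont.eventually_mem (isOpen_Ioo.mem_nhds ⟨hgt, hlt⟩)] with θ h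
    simp only [circleLift, Cover.coord_mk, chartFactor, cond_true]
    rw [(Int.ceil_eq_iff (z := ⌈v⌉)).2 ⟨h.1, h.2.le⟩]

/-- Along a lift of a curve winding `m` times around the circle `b`, the fibre coordinate gets
multiplied by `s b ^ m`. -/
theorem Cover.coord_of_winding {Γ : ℝ → Cover s} {φ : ℝ → ℝ} {u v : ℝ} (huv : u ≤ v)
    (hΓ : ContinuousOn Γ (Icc u v)) (hφ : ContinuousOn φ (Icc u v)) {b : Bool}
    (h : ∀ t ∈ Icc u v, (Γ t).1 = circlePoint b (φ t)) (hu : φ u = 0) {m : ℤ}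
    (hv : φ v = 2 * Real.pi * m) : coord (Γ v) = s b ^ m * coord (Γ u) := by
  -- The shift by `1 / 2` makes the exponent at angle `2πm` exactly `m`.
  have h0 : ⌈(0 : ℝ) / (2 * Real.pi) - 1 / 2⌉ = 0 := by
    rw [Int.ceil_eq_iff]
    norm_num
  have hm : ⌈2 * Real.pi * m / (2 * Real.pi) - 1 / 2⌉ = m := by
    rw [mul_div_cancel_left₀ _ (by positivity), Int.ceil_eq_iff]
    constructor <;> linarith
  have := (isCoveringMap_proj s).eqOn_of_comp_eqOn isPreconnected_Icc hΓ
    ((continuous_circleLift b (coord (Γ u))).comp_continuousOn hφ) (fun t ht => h t ht)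
    (left_mem_Icc.2 huv) (Cover.ext (h u (left_mem_Icc.2 huv)) (by
      simp only [Function.comp_apply, hu, circleLift, coord_mk]
      rw [h0, zpow_zero, one_mul]))
  rw [this (right_mem_Icc.2 huv)]
  simp only [Function.comp_apply, hv, circleLift, coord_mk]
  rw [hm]

end WedgeOfCircles
end

/-! ### Degrees in products of elementary polynomial matrices -/

noncomputable section

open Polynomial

/-- The group of polynomial matrices in which the fundamental groups are detected. -/
abbrev PolySL : Type := Matrix.SpecialLinearGroup (Fin 2) ℤ[X]

namespace PolySL

/-- The discrete topology. -/
instance topology : TopologicalSpace PolySL := ⊥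

instance : DiscreteTopology PolySL := ⟨rfl⟩

/-- The elementary matrices `1 + cX E₁₂` (for `true`) and `1 + cX E₂₁` (for `false`). -/
def elementary : Bool → ℤ → PolySL
  | true, c => ⟨!![1, C c * X; 0, 1], by rw [Matrix.det_fin_two_of]; ring⟩
  | false, c => ⟨!![1, 0; C c * X, 1], by rw [Matrix.det_fin_two_of]; ring⟩

theorem coe_elementary_true (c : ℤ) : (elementary true c).1 = !![1, C c * X; 0, 1] := rfl

theorem coe_elementary_false (c : ℤ) : (elementary false c).1 = !![1, 0; C c * X, 1] := rfl

theorem elementary_add (b : Bool) (c d : ℤ) :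
    elementary b (c + d) = elementary b c * elementary b d := by
  apply Subtype.ext
  rw [Matrix.SpecialLinearGroup.coe_mul]
  cases b
  · simp [coe_elementary_false, add_mul]
  · simp [coe_elementary_true, add_mul, add_comm]

/-- The monodromy of the covering of the wedge of two circles. -/
def generator (b : Bool) : PolySL := elementary b 1

theorem generator_zpow (b : Bool) (m : ℤ) : generator b ^ m = elementary b m := by
  have h0 : elementary b 0 = 1 := by
    simpa using elementary_add b 0 0
  induction m using Int.induction_on with
  | zero => rw [h0, zpow_zero]
  | succ n ih => rw [zpow_add_one, ih, elementary_add]; rfl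
  | pred n ih =>
    rw [zpow_sub_one, ih, mul_inv_eq_iff_eq_mul]
    exact (congrArg (elementary b) (by ring)).trans (elementary_add b (-n - 1) 1)

/-- All entries have degree at most `n`. -/
def DegreeLE (n : ℕ) (M : PolySL) : Prop := ∀ i j, (M.1 i j).natDegree ≤ n

theorem degreeLE_one : DegreeLE 0 1 := by
  intro i j
  fin_cases i <;> fin_cases j <;> simp

theorem DegreeLE.mul {n k : ℕ} {M N : PolySL} (hM : DegreeLE n M) (hN : DegreeLE k N) :
    DegreeLE (n + k) (M * N) := by
  intro i j
  rw [Matrix.SpecialLinearGroup.coe_mul, Matrix.mul_apply]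
  exact natDegree_sum_le_of_forall_le _ _ fun l _ => natDegree_mul_le_of_le (hM i l) (hN l j)

/-- The exponent enters only as the coefficient of `X`. This is the purpose of polynomial entries:
the degree ignores winding numbers and sees only changes of generator. -/
theorem degreeLE_of_mem_zpowers {b : Bool} {M : PolySL}
    (hM : M ∈ Subgroup.zpowers (generator b)) : DegreeLE 1 M := by
  obtain ⟨m, rfl⟩ := Subgroup.mem_zpowers_iff.1 hM
  rw [generator_zpow]
  intro i j
  cases b <;> fin_cases i <;> fin_cases j <;>
    simp [coe_elementary_false, coe_elementary_true] <;>
    exact (natDegree_C_mul_le _ _).trans (by simp)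

theorem DegreeLE.trace {n : ℕ} {M : PolySL} (hM : DegreeLE n M) :
    M.1.trace.natDegree ≤ n := by
  rw [Matrix.trace_fin_two]
  exact natDegree_add_le_of_degree_le (hM 0 0) (hM 1 1)

theorem trace_eq_of_isConj {M N : PolySL} (h : IsConj M N) : M.1.trace = N.1.trace := by
  obtain ⟨c, rfl⟩ := isConj_iff.1 h
  rw [Matrix.SpecialLinearGroup.coe_mul, Matrix.trace_mul_comm,
    ← Matrix.SpecialLinearGroup.coe_mul, ← mul_assoc, inv_mul_cancel, one_mul]

theorem generator_ne_one (b : Bool) : generator b ≠ 1 := by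
  intro h
  cases b
  · have := congrFun (congrFun (congrArg Subtype.val h) 1) 0
    simp [generator, coe_elementary_false] at this
  · have := congrFun (congrFun (congrArg Subtype.val h) 0) 1
    simp [generator, coe_elementary_true] at this

/-- The generator going with the `k`-th circle of an alternating sequence. -/
def alternating (k : ℕ) : Bool := decide (Even k)

/-- The holonomy of the first `n` windings of a loop winding in alternation. -/
def alternatingProduct (m : ℕ → ℤ) : ℕ → PolySL
  | 0 => 1
  | n + 1 => generator (alternating n) ^ m n * alternatingProduct m n

/-- Each further pair of factors raises the degree of the lower right entry by two and multiplies
its leading coefficient by two of the nonzero `m k`. The upper left entry has smaller degree, so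
nothing cancels in the trace. -/
theorem le_natDegree_trace_alternatingProduct {m : ℕ → ℤ} (hm : ∀ k, m k ≠ 0) (n : ℕ) :
    2 * (n + 1) ≤ (alternatingProduct m (2 * (n + 1))).1.trace.natDegree := by
  have step : ∀ n, alternatingProduct m (2 * (n + 1)) =
      elementary false (m (2 * n + 1)) * (elementary true (m (2 * n)) *
        alternatingProduct m (2 * n)) := by
    intro n
    rw [show 2 * (n + 1) = 2 * n + 1 + 1 by ring, alternatingProduct, alternatingProduct,
      generator_zpow, generator_zpow]
    simp [alternating]
  -- The bounds on the other entries keep the induction closed: they ensure that only the lower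
  -- right entry feeds the new leading coefficient.
  have key : ∀ n, ((alternatingProduct m (2 * (n + 1))).1 0 0).natDegree ≤ 2 * n ∧
      ((alternatingProduct m (2 * (n + 1))).1 0 1).natDegree ≤ 2 * n + 1 ∧
      ((alternatingProduct m (2 * (n + 1))).1 1 0).natDegree ≤ 2 * n + 1 ∧
      ((alternatingProduct m (2 * (n + 1))).1 1 1).natDegree ≤ 2 * n + 2 ∧
      ((alternatingProduct m (2 * (n + 1))).1 1 1).coeff (2 * n + 2) ≠ 0 := by
    intro n
    induction n with
    | zero =>
      have h : (alternatingProduct m (2 * (0 + 1))).1 =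
          !![1, C (m 0) * X; C (m 1) * X, C (m 1) * X * (C (m 0) * X) + 1] := by
        rw [step, Matrix.SpecialLinearGroup.coe_mul, Matrix.SpecialLinearGroup.coe_mul,
          coe_elementary_false, coe_elementary_true]
        simp [alternatingProduct]
      rw [h]
      have h2 : C (m 1) * X * (C (m 0) * X) + 1 = C (m 1 * m 0) * X ^ 2 + 1 := by
        rw [C_mul]
        ring
      refine ⟨by simp, ?_, ?_, ?_, ?_⟩
      · simp only [Matrix.of_apply, Matrix.cons_val]
        compute_degree
      · simp only [Matrix.of_apply, Matrix.cons_val]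
        compute_degree
      · simp only [Matrix.of_apply, Matrix.cons_val]
        compute_degree
      · simp only [Matrix.of_apply, Matrix.cons_val]
        rw [h2, coeff_add, coeff_C_mul_X_pow, coeff_one]
        simpa using ⟨hm 1, hm 0⟩
    | succ n ih =>
      rw [step (n + 1), Matrix.SpecialLinearGroup.coe_mul, Matrix.SpecialLinearGroup.coe_mul,
        coe_elementary_false, coe_elementary_true]
      generalize (alternatingProduct m (2 * (n + 1))).1 = M at ih
      obtain ⟨h1, h2, h3, h4, h5⟩ := ih
      have hk := hm (2 * (n + 1))
      have hl := hm (2 * (n + 1) + 1)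
      generalize m (2 * (n + 1)) = k at *
      generalize m (2 * (n + 1) + 1) = l at *
      have hP : !![1, 0; C l * X, 1] * (!![1, C k * X; 0, 1] * M) =
          !![M 0 0 + C k * X * M 1 0, M 0 1 + C k * X * M 1 1;
            C l * X * (M 0 0 + C k * X * M 1 0) + M 1 0,
            C l * X * (M 0 1 + C k * X * M 1 1) + M 1 1] := by
        conv_lhs => rw [Matrix.eta_fin_two M, Matrix.mul_fin_two, Matrix.mul_fin_two]
        simp only [one_mul, zero_mul, zero_add, add_zero]
      rw [hP]
      have hmul : ∀ (e : ℤ) {p : ℤ[X]} {j : ℕ}, p.natDegree ≤ j →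
          (C e * X * p).natDegree ≤ j + 1 := fun e p j h => by
        rw [add_comm]
        exact natDegree_mul_le_of_le ((natDegree_C_mul_le _ _).trans natDegree_X_le) h
      have hA : (M 0 0 + C k * X * M 1 0).natDegree ≤ 2 * n + 2 :=
        natDegree_add_le_of_degree_le (h1.trans (by omega)) (hmul k h3)
      have hB : (M 0 1 + C k * X * M 1 1).natDegree ≤ 2 * n + 3 :=
        natDegree_add_le_of_degree_le (h2.trans (by omega)) (hmul k h4)
      refine ⟨hA, hB, ?_, ?_, ?_⟩
      · exact natDegree_add_le_of_degree_le (hmul l hA) (h3.trans (by omega))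
      · exact natDegree_add_le_of_degree_le (hmul l hB) (h4.trans (by omega))
      · change (C l * X * (M 0 1 + C k * X * M 1 1) + M 1 1).coeff (2 * n + 2 + 1 + 1) ≠ 0
        rw [coeff_add, mul_assoc, coeff_C_mul, coeff_X_mul, coeff_add, mul_assoc, coeff_C_mul,
          coeff_X_mul, coeff_eq_zero_of_natDegree_lt (p := M 0 1) (by omega),
          coeff_eq_zero_of_natDegree_lt (p := M 1 1) (n := 2 * n + 2 + 1 + 1) (by omega),
          zero_add, add_zero]
        exact mul_ne_zero hl (mul_ne_zero hk h5)
  obtain ⟨h1, -, -, -, h2⟩ := key n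
  refine le_natDegree_of_ne_zero ?_
  rw [Matrix.trace_fin_two, coeff_add, coeff_eq_zero_of_natDegree_lt (by omega), zero_add]
  exact h2

end PolySL
end

/-! ### A complex coordinate in which the tangent line is the imaginary axis -/

noncomputable section

open scoped ComplexConjugate

/-- The diameter determines the radius. If the centres differed, the point of the first sphere
farthest from `c'` would be at distance `ρ + ‖c - c'‖` from it. This recovers the centre and radius
left existential in `WindsAround`. -/
theorem Metric.sphere_injective {V : Type*} [NormedAddCommGroup V] [NormedSpace ℝ V]
    [Nontrivial V] {c c' : V} {ρ ρ' : ℝ} (hρ : 0 ≤ ρ) (hρ' : 0 ≤ ρ')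
    (h : Metric.sphere c ρ = Metric.sphere c' ρ') : c = c' ∧ ρ = ρ' := by
  have hr : ρ = ρ' := by
    have := congrArg Metric.diam h
    rw [Metric.diam_sphere_eq c hρ, Metric.diam_sphere_eq c' hρ'] at this
    linarith
  refine ⟨?_, hr⟩
  subst hr
  by_contra hc
  have hd : 0 < ‖c - c'‖ := norm_pos_iff.2 (sub_ne_zero.2 hc)
  have hmem : c + (ρ / ‖c - c'‖) • (c - c') ∈ Metric.sphere c ρ := by
    rw [mem_sphere_iff_norm, add_sub_cancel_left, norm_smul, Real.norm_eq_abs,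
      abs_of_nonneg (by positivity)]
    field_simp
  rw [h, mem_sphere_iff_norm,
    show c + (ρ / ‖c - c'‖) • (c - c') - c' = (1 + ρ / ‖c - c'‖) • (c - c') by module,
    norm_smul, Real.norm_eq_abs, abs_of_nonneg (by positivity), add_mul, one_mul,
    div_mul_cancel₀ _ hd.ne'] at hmem
  linarith

/-- The identification of the Euclidean plane with the complex plane. -/
def planeToComplex : Plane ≃ₗᵢ[ℝ] ℂ := Complex.orthonormalBasisOneI.repr.symm

theorem planeToComplex_apply (p : Plane) : planeToComplex p = p 0 + p 1 * Complex.I :=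
  Complex.orthonormalBasisOneI_repr_symm_apply p

theorem planeToComplex_cos_sin (θ : ℝ) :
    planeToComplex !₂[Real.cos θ, Real.sin θ] = Complex.exp (θ * Complex.I) := by
  rw [planeToComplex_apply, Complex.exp_mul_I]
  simp

theorem re_planeToComplex_mul_conj (p q : Plane) :
    (planeToComplex p * conj (planeToComplex q)).re = inner ℝ q p := by
  rw [planeToComplex_apply, planeToComplex_apply, PiLp.inner_apply]
  simp

namespace HawaiianEarring

variable (E : HawaiianEarring)

/-- The direction of the axis as a complex number. -/
def direction : ℂ := planeToComplex E.u

theorem norm_direction : ‖E.direction‖ = 1 := by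
  rw [direction, LinearIsometryEquiv.norm_map, E.norm_u]

theorem direction_ne_zero : E.direction ≠ 0 := norm_pos_iff.1 (by simp [norm_direction])

/-- The complex coordinate of the plane with origin `a` and real axis along `u`. -/
def chart (p : Plane) : ℂ := planeToComplex (p - E.a) / E.direction

/-- The inverse of the complex coordinate. -/
def point (w : ℂ) : Plane := E.a + planeToComplex.symm (w * E.direction)

@[simp] theorem chart_point (w : ℂ) : E.chart (E.point w) = w := by
  simp [chart, point, E.direction_ne_zero]

@[simp] theorem point_chart (p : Plane) : E.point (E.chart p) = p := by
  simp [chart, point, E.direction_ne_zero]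

theorem continuous_chart : Continuous E.chart := by
  unfold chart
  fun_prop

theorem continuous_point : Continuous E.point := by
  unfold point
  fun_prop

theorem point_zero : E.point 0 = E.a := by simp [point]

theorem chart_a : E.chart E.a = 0 := by simp [chart]

theorem chart_eq_zero_iff {p : Plane} : E.chart p = 0 ↔ p = E.a :=
  ⟨fun h => by rw [← E.point_chart p, h, point_zero], fun h => by rw [h, chart_a]⟩

theorem mem_sphere_iff (p : Plane) (x r : ℝ) :
    p ∈ Metric.sphere (E.a + x • E.u) r ↔ ‖E.chart p - x‖ = r := by
  have : planeToComplex (p - (E.a + x • E.u)) = (E.chart p - x) * E.direction := by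
    rw [chart, sub_mul, div_mul_cancel₀ _ E.direction_ne_zero, ← sub_sub, map_sub, map_smul]
    simp [direction]
  rw [mem_sphere_iff_norm, ← planeToComplex.norm_map, this, norm_mul, norm_direction, mul_one]

theorem norm_sub_ofReal_eq_abs_iff (w : ℂ) (x : ℝ) :
    ‖w - x‖ = |x| ↔ ‖w‖ ^ 2 = 2 * x * w.re := by
  rw [← sq_eq_sq₀ (norm_nonneg _) (abs_nonneg _), sq_abs, Complex.sq_norm, Complex.sq_norm,
    Complex.normSq_apply, Complex.normSq_apply]
  simp
  constructor <;> intro h <;> linarith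

theorem chart_reflect (p : Plane) : E.chart (E.reflect p) = -conj (E.chart p) := by
  have hdir : E.tangentLine.direction = (Submodule.span ℝ {E.u})ᗮ :=
    AffineSubspace.direction_mk' _ _
  have hd := E.norm_direction
  have hr : E.reflect p = (p - E.a) - (2 * inner ℝ E.u (p - E.a)) • E.u + E.a := by
    rw [reflect, EuclideanGeometry.reflection_apply_of_mem E.tangentLine p
      (AffineSubspace.self_mem_mk' E.a _)]
    -- Stating this for a variable `K` lets the equality of subspaces be substituted together with
    -- the projection instance.
    have : ∀ (K : Submodule ℝ Plane) [K.HasOrthogonalProjection],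
        K = (Submodule.span ℝ {E.u})ᗮ → K.reflection (p - E.a) =
          (p - E.a) - (2 * inner ℝ E.u (p - E.a)) • E.u := by
      rintro K _ rfl
      rw [Submodule.reflection_orthogonal_apply, Submodule.reflection_singleton_apply, E.norm_u]
      simp [two_smul, two_mul, add_smul]
    exact congrArg (· + E.a) (this _ hdir)
  have hinv : (E.direction)⁻¹ = conj E.direction := by
    rw [Complex.inv_def, Complex.normSq_eq_norm_sq, hd]
    simp
  have hre : inner ℝ E.u (p - E.a) = (E.chart p).re := by
    rw [← re_planeToComplex_mul_conj, chart, div_eq_mul_inv, hinv, direction]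
  have : E.chart (E.reflect p) = E.chart p - 2 * (E.chart p).re := by
    rw [hr, hre, chart, add_sub_cancel_right, map_sub, map_smul, sub_div]
    congr 1
    rw [Complex.real_smul, ← direction, mul_div_cancel_right₀ _ E.direction_ne_zero]
    push_cast
    ring
  rw [this]
  apply Complex.ext <;> simp
  ring

theorem reflect_reflect (p : Plane) : E.reflect (E.reflect p) = p :=
  EuclideanGeometry.reflection_reflection _ p

theorem circle'_eq_sphere (n : ℕ) :
    E.circle' n = Metric.sphere (E.a + (-E.radius n) • E.u) (E.radius n) := by
  ext p
  have : p ∈ E.circle' n ↔ E.reflect p ∈ E.circle n :=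
    ⟨fun ⟨q, hq, h⟩ => by rw [← h, reflect_reflect]; exact hq,
      fun h => ⟨_, h, E.reflect_reflect p⟩⟩
  rw [this, circle, mem_sphere_iff, mem_sphere_iff, chart_reflect, ← norm_neg,
    ← Complex.norm_conj]
  simp [add_comm]

theorem mem_circle_iff {n : ℕ} {p : Plane} :
    p ∈ E.circle n ↔ ‖E.chart p‖ ^ 2 = 2 * E.radius n * (E.chart p).re := by
  rw [circle, mem_sphere_iff, ← norm_sub_ofReal_eq_abs_iff, abs_of_pos (E.radius_pos n)]

theorem mem_circle'_iff {n : ℕ} {p : Plane} :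
    p ∈ E.circle' n ↔ ‖E.chart p‖ ^ 2 = 2 * E.radius n * -(E.chart p).re := by
  rw [circle'_eq_sphere, mem_sphere_iff,
    show 2 * E.radius n * -(E.chart p).re = 2 * (-E.radius n) * (E.chart p).re by ring,
    ← norm_sub_ofReal_eq_abs_iff, abs_neg, abs_of_pos (E.radius_pos n)]

theorem mem_H_iff {p : Plane} :
    p ∈ E.H ↔ ∃ n, ‖E.chart p‖ ^ 2 = 2 * E.radius n * (E.chart p).re := by
  simp [H, mem_circle_iff]

theorem mem_H'_iff {p : Plane} :
    p ∈ E.H' ↔ ∃ n, ‖E.chart p‖ ^ 2 = 2 * E.radius n * -(E.chart p).re := by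
  have : E.H' = ⋃ n, E.circle' n := by
    simp only [H', H, circle', image_iUnion]
  simp [this, mem_circle'_iff]

theorem re_nonneg_of_mem_H {p : Plane} (hp : p ∈ E.H) : 0 ≤ (E.chart p).re := by
  obtain ⟨n, h⟩ := E.mem_H_iff.1 hp
  exact nonneg_of_mul_nonneg_right (h ▸ sq_nonneg _) (by linarith [E.radius_pos n])

theorem re_nonpos_of_mem_H' {p : Plane} (hp : p ∈ E.H') : (E.chart p).re ≤ 0 := by
  obtain ⟨n, h⟩ := E.mem_H'_iff.1 hp
  linarith [nonneg_of_mul_nonneg_right (h ▸ sq_nonneg _) (by linarith [E.radius_pos n])]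

theorem a_mem_H : E.a ∈ E.H := E.mem_H_iff.2 ⟨0, by simp [chart_a]⟩

theorem a_mem_H' : E.a ∈ E.H' := E.mem_H'_iff.2 ⟨0, by simp [chart_a]⟩

/-- Every circle is tangent to the line at `a`: its equation forces `‖E.chart p‖ = 0` when the real
part vanishes. -/
theorem eq_a_of_re_eq_zero {p : Plane} (hp : p ∈ E.Y) (h : (E.chart p).re = 0) : p = E.a := by
  rw [← chart_eq_zero_iff]
  rcases hp with hp | hp
  · obtain ⟨n, h'⟩ := E.mem_H_iff.1 hp
    simpa [h] using h'
  · obtain ⟨n, h'⟩ := E.mem_H'_iff.1 hp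
    simpa [h] using h'

theorem H_inter_H' : E.H ∩ E.H' = {E.a} := by
  ext p
  constructor
  · rintro ⟨h, h'⟩
    exact E.eq_a_of_re_eq_zero (Or.inl h)
      (le_antisymm (E.re_nonpos_of_mem_H' h') (E.re_nonneg_of_mem_H h))
  · rintro rfl
    exact ⟨E.a_mem_H, E.a_mem_H'⟩

theorem mem_H_of_re_nonneg {p : Plane} (hp : p ∈ E.Y) (h : 0 ≤ (E.chart p).re) : p ∈ E.H := by
  rcases hp with hp | hp
  · exact hp
  · rw [E.eq_a_of_re_eq_zero (Or.inr hp) (le_antisymm (E.re_nonpos_of_mem_H' hp) h)]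
    exact E.a_mem_H

theorem mem_H'_of_re_nonpos {p : Plane} (hp : p ∈ E.Y) (h : (E.chart p).re ≤ 0) : p ∈ E.H' := by
  rcases hp with hp | hp
  · rw [E.eq_a_of_re_eq_zero (Or.inl hp) (le_antisymm h (E.re_nonneg_of_mem_H hp))]
    exact E.a_mem_H'
  · exact hp

/-- The signed radius of the `k`-th circle of the alternating sequence. -/
def signedRadius (k : ℕ) : ℝ := if Even k then E.radius (k / 2) else -E.radius (k / 2)

theorem abs_signedRadius (k : ℕ) : |E.signedRadius k| = E.radius (k / 2) := by
  unfold signedRadius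
  split_ifs <;> simp [abs_of_pos (E.radius_pos _)]

theorem alternatingCircle_eq_sphere (k : ℕ) : E.alternatingCircle k =
    Metric.sphere (E.a + E.signedRadius k • E.u) |E.signedRadius k| := by
  rw [abs_signedRadius]
  unfold alternatingCircle signedRadius
  split_ifs
  · rfl
  · exact E.circle'_eq_sphere _

theorem alternatingCircle_subset_Y (k : ℕ) : E.alternatingCircle k ⊆ E.Y := by
  unfold alternatingCircle
  split_ifs
  · exact fun p hp => Or.inl (mem_iUnion.2 ⟨_, hp⟩)
  · rintro _ ⟨p, hp, rfl⟩
    exact Or.inr ⟨p, mem_iUnion.2 ⟨_, hp⟩, rfl⟩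

/-- A curve starting at `a` winds `m` times around a circle through `a` centred on the axis if and
only if its angle, measured from `a`, changes by `2πm`. -/
theorem windsAround_iff {f : ℝ → Plane} {s t : ℝ} (hst : s ≤ t) (hs : f s = E.a) {ρ : ℝ}
    (hρ : ρ ≠ 0) {m : ℤ} :
    WindsAround f s t (Metric.sphere (E.a + ρ • E.u) |ρ|) m ↔
      ∃ φ : ℝ → ℝ, ContinuousOn φ (Icc s t) ∧
        (∀ x ∈ Icc s t, E.chart (f x) = ρ * (1 - Complex.exp (φ x * Complex.I))) ∧
        φ s = 0 ∧ φ t = 2 * Real.pi * m := by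
  have hchart : ∀ (p : Plane) (θ : ℝ), p = (E.a + ρ • E.u) + |ρ| • !₂[Real.cos θ, Real.sin θ] ↔
      E.chart p = ρ + (|ρ| : ℝ) * (Complex.exp (θ * Complex.I) / E.direction) := by
    intro p θ
    have : E.chart ((E.a + ρ • E.u) + |ρ| • !₂[Real.cos θ, Real.sin θ]) =
        ρ + (|ρ| : ℝ) * (Complex.exp (θ * Complex.I) / E.direction) := by
      rw [chart, show (E.a + ρ • E.u) + |ρ| • !₂[Real.cos θ, Real.sin θ] - E.a =
        ρ • E.u + |ρ| • !₂[Real.cos θ, Real.sin θ] by abel, map_add, map_smul, map_smul,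
        planeToComplex_cos_sin, add_div, ← direction, Complex.real_smul, Complex.real_smul,
        mul_div_cancel_right₀ _ E.direction_ne_zero, mul_div_assoc]
    constructor
    · rintro rfl
      exact this
    · intro h
      rw [← E.point_chart p, h, ← this, point_chart]
  have hρ' : (ρ : ℂ) ≠ 0 := by exact_mod_cast hρ
  constructor
  · rintro ⟨c, r, θ, hr, hD, hθ, hf, hm⟩
    obtain ⟨rfl, rfl⟩ := Metric.sphere_injective (abs_nonneg ρ) hr.le hD
    refine ⟨fun x => θ x - θ s, hθ.sub continuousOn_const, fun x hx => ?_, sub_self _, hm⟩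
    have h0 := (hchart _ _).1 (hf s (left_mem_Icc.2 hst))
    rw [hs, chart_a] at h0
    rw [(hchart _ _).1 (hf x hx)]
    push_cast
    rw [sub_mul, Complex.exp_sub]
    -- The condition that the curve starts at `a` determines the initial angle.
    have h1 : ((|ρ| : ℝ) : ℂ) / E.direction = -ρ / Complex.exp (θ s * Complex.I) := by
      rw [eq_div_iff (Complex.exp_ne_zero _)]
      linear_combination -h0
    linear_combination Complex.exp (θ x * Complex.I) * h1
  · rintro ⟨φ, hφ, hf, h0, hm⟩
    -- `θ₀` is the angle of `a` as seen from the centre `a + ρu`.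
    obtain ⟨θ₀, hθ₀⟩ : ∃ θ₀ : ℝ, Complex.exp (θ₀ * Complex.I) = -ρ / (|ρ| : ℝ) * E.direction := by
      have hn : ‖(-ρ / (|ρ| : ℝ) * E.direction : ℂ)‖ = 1 := by
        rw [norm_mul, norm_direction, norm_div, norm_neg, Complex.norm_real, Complex.norm_real]
        simp [hρ]
      exact (Complex.norm_eq_one_iff _).1 hn
    refine ⟨_, _, fun x => φ x + θ₀, abs_pos.2 hρ, rfl, hφ.add continuousOn_const,
      fun x hx => ?_, ?_⟩
    · rw [hchart, hf x hx]
      push_cast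
      rw [add_mul, Complex.exp_add, hθ₀]
      have : ((|ρ| : ℝ) : ℂ) ≠ 0 := by exact_mod_cast abs_ne_zero.2 hρ
      have := E.direction_ne_zero
      field_simp
      ring
    · simp only [h0, hm]
      ring

end HawaiianEarring
end

/-! ### The projection is a shy surjection -/

noncomputable section

namespace HawaiianEarring

variable (E : HawaiianEarring)

theorem continuous_re_chart : Continuous fun y : E.Y => (E.chart y).re :=
  Complex.continuous_re.comp (E.continuous_chart.comp continuous_subtype_val)

/-- The section of the projection over `H`, extended by collapsing `H'` to `a`. -/
def lowerSection : C(E.Y, E.X) where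
  toFun y := ⟨(if 0 ≤ (E.chart y).re then y else E.a, 0), by
    split_ifs with h
    · exact Or.inl (Or.inl ⟨E.mem_H_of_re_nonneg y.2 h, rfl⟩)
    · exact Or.inl (Or.inl ⟨E.a_mem_H, rfl⟩)⟩
  continuous_toFun := by
    refine Continuous.subtype_mk (.prodMk ?_ continuous_const) _
    refine continuous_if_le continuous_const E.continuous_re_chart
      continuous_subtype_val.continuousOn continuousOn_const fun y hy => ?_
    exact E.eq_a_of_re_eq_zero y.2 hy.symm

/-- The section of the projection over `H'`, extended by collapsing `H` to `a`. -/
def upperSection : C(E.Y, E.X) where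
  toFun y := ⟨(if (E.chart y).re ≤ 0 then y else E.a, 1), by
    split_ifs with h
    · exact Or.inl (Or.inr ⟨E.mem_H'_of_re_nonpos y.2 h, rfl⟩)
    · exact Or.inl (Or.inr ⟨E.a_mem_H', rfl⟩)⟩
  continuous_toFun := by
    refine Continuous.subtype_mk (.prodMk ?_ continuous_const) _
    refine continuous_if_le E.continuous_re_chart continuous_const
      continuous_subtype_val.continuousOn continuousOn_const fun y hy => ?_
    exact E.eq_a_of_re_eq_zero y.2 hy

/-- The segment of `X` connecting the two earrings. -/
def segmentMap : C(unitInterval, E.X) where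
  toFun t := ⟨(E.a, t), Or.inr ⟨rfl, t.2⟩⟩
  continuous_toFun := by fun_prop

theorem lowerSection_of_nonneg {y : E.Y} (h : 0 ≤ (E.chart y).re) :
    (E.lowerSection y).1 = (y.1, 0) := by
  simp [lowerSection, h]

theorem upperSection_of_nonpos {y : E.Y} (h : (E.chart y).re ≤ 0) :
    (E.upperSection y).1 = (y.1, 1) := by
  simp [upperSection, h]

theorem proj_lowerSection (y : E.Y) :
    E.proj (E.lowerSection y) = y ∨ E.proj (E.lowerSection y) = ⟨E.a, E.a_mem_Y⟩ := by
  by_cases h : 0 ≤ (E.chart y).re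
  · exact Or.inl (Subtype.ext (congrArg Prod.fst (E.lowerSection_of_nonneg h)))
  · exact Or.inr (Subtype.ext (by simp [proj, lowerSection, h]))

theorem proj_upperSection (y : E.Y) :
    E.proj (E.upperSection y) = y ∨ E.proj (E.upperSection y) = ⟨E.a, E.a_mem_Y⟩ := by
  by_cases h : (E.chart y).re ≤ 0
  · exact Or.inl (Subtype.ext (congrArg Prod.fst (E.upperSection_of_nonpos h)))
  · exact Or.inr (Subtype.ext (by simp [proj, upperSection, h]))

theorem eq_section_or_mem_segment (x : E.X) :
    (0 ≤ (E.chart (E.proj x)).re ∧ x = E.lowerSection (E.proj x)) ∨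
      ((E.chart (E.proj x)).re ≤ 0 ∧ x = E.upperSection (E.proj x)) ∨ x ∈ range E.segmentMap := by
  have hext : ∀ z, x.1.2 = z → (x.1 : Plane × ℝ) = ((E.proj x).1, z) := fun z hz => Prod.ext rfl hz
  rcases x.2 with (⟨h1, h2⟩ | ⟨h1, h2⟩) | ⟨h1, h2⟩
  · have h : 0 ≤ (E.chart (E.proj x)).re := E.re_nonneg_of_mem_H h1
    refine Or.inl ⟨h, Subtype.ext ?_⟩
    rw [lowerSection_of_nonneg _ (y := E.proj x) h]
    exact hext 0 h2
  · have h : (E.chart (E.proj x)).re ≤ 0 := E.re_nonpos_of_mem_H' h1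
    refine Or.inr (Or.inl ⟨h, Subtype.ext ?_⟩)
    rw [upperSection_of_nonpos _ (y := E.proj x) h]
    exact hext 1 h2
  · exact Or.inr (Or.inr ⟨⟨x.1.2, h2⟩, Subtype.ext (Prod.ext (Eq.symm h1) rfl)⟩)

theorem proj_segmentMap (t : unitInterval) : E.proj (E.segmentMap t) = ⟨E.a, E.a_mem_Y⟩ := rfl

theorem surjective_proj : Function.Surjective E.proj := by
  rintro ⟨p, hp | hp⟩
  · exact ⟨⟨(p, 0), Or.inl (Or.inl ⟨hp, rfl⟩)⟩, rfl⟩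
  · exact ⟨⟨(p, 1), Or.inl (Or.inr ⟨hp, rfl⟩)⟩, rfl⟩

/-- If `a ∈ A`, the preimage is the union of the images of `A` under the two sections and of the
segment, which meets both. If `a ∉ A`, the real part of the coordinate has no zero on `A`, so `A`
lies on one side and its preimage is the image under one section. -/
theorem isShy_proj : IsShy E.proj := by
  refine ⟨E.proj.continuous, fun A _ hA => ?_⟩
  by_cases ha : (⟨E.a, E.a_mem_Y⟩ : E.Y) ∈ A
  · have : PathConnectedSpace unitInterval := isPathConnected_iff_pathConnectedSpace.1
      ((convex_Icc (0 : ℝ) 1).isPathConnected ⟨0, by simp⟩)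
    have hlow := hA.image E.lowerSection.continuous
    have hup := hA.image E.upperSection.continuous
    have hseg : IsPathConnected (range E.segmentMap) :=
      isPathConnected_range E.segmentMap.continuous
    have h0 : (E.segmentMap 0) ∈ E.lowerSection '' A :=
      ⟨_, ha, Subtype.ext ((E.lowerSection_of_nonneg (by simp [chart_a])).trans rfl)⟩
    have h1 : (E.segmentMap 1) ∈ E.upperSection '' A :=
      ⟨_, ha, Subtype.ext ((E.upperSection_of_nonpos (by simp [chart_a])).trans rfl)⟩
    have := (hlow.union hseg ⟨_, h0, mem_range_self _⟩).union hup
      ⟨_, Or.inr (mem_range_self _), h1⟩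
    convert this using 1
    ext x
    constructor
    · intro hx
      rcases E.eq_section_or_mem_segment x with h | h | h
      · exact Or.inl (Or.inl ⟨_, hx, h.2.symm⟩)
      · exact Or.inr ⟨_, hx, h.2.symm⟩
      · exact Or.inl (Or.inr h)
    · rintro ((⟨y, hy, rfl⟩ | ⟨t, rfl⟩) | ⟨y, hy, rfl⟩)
      · rcases E.proj_lowerSection y with h | h <;> simpa [h]
      · exact ha
      · rcases E.proj_upperSection y with h | h <;> simpa [h]
  · have hne : ∀ y ∈ A, (E.chart y).re ≠ 0 := fun y hy h => by
      rw [← show y = ⟨E.a, E.a_mem_Y⟩ from Subtype.ext (E.eq_a_of_re_eq_zero y.2 h)] at ha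
      exact ha hy
    have hconn : (∀ y ∈ A, 0 < (E.chart y).re) ∨ (∀ y ∈ A, (E.chart y).re < 0) := by
      by_contra! h
      obtain ⟨⟨y, hy, h⟩, y', hy', h'⟩ := h
      obtain ⟨z, hz, h0⟩ := hA.isConnected.isPreconnected.intermediate_value hy hy'
        E.continuous_re_chart.continuousOn ⟨h, h'⟩
      exact hne z hz h0
    have hsegA : ∀ t, E.proj (E.segmentMap t) ∉ A := fun t h => ha (E.proj_segmentMap t ▸ h)
    rcases hconn with hpos | hneg
    · convert hA.image E.lowerSection.continuous using 1
      ext x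
      constructor
      · intro hx
        rcases E.eq_section_or_mem_segment x with h | h | ⟨t, rfl⟩
        · exact ⟨_, hx, h.2.symm⟩
        · exact absurd h.1 (hpos _ hx).not_ge
        · exact absurd hx (hsegA t)
      · rintro ⟨y, hy, rfl⟩
        have : E.proj (E.lowerSection y) = y :=
          Subtype.ext (congrArg Prod.fst (E.lowerSection_of_nonneg (hpos y hy).le))
        simpa [this]
    · convert hA.image E.upperSection.continuous using 1
      ext x
      constructor
      · intro hx
        rcases E.eq_section_or_mem_segment x with h | h | ⟨t, rfl⟩
        · exact absurd h.1 (hneg _ hx).not_ge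
        · exact ⟨_, hx, h.2.symm⟩
        · exact absurd hx (hsegA t)
      · rintro ⟨y, hy, rfl⟩
        have : E.proj (E.upperSection y) = y :=
          Subtype.ext (congrArg Prod.fst (E.upperSection_of_nonpos (hneg y hy).le))
        simpa [this]

theorem isPathConnected_alternatingCircle (k : ℕ) : IsPathConnected (E.alternatingCircle k) := by
  rw [alternatingCircle_eq_sphere]
  refine isPathConnected_sphere ?_ _ (abs_nonneg _)
  rw [← Module.finrank_eq_rank, finrank_euclideanSpace_fin]
  norm_num

theorem exists_mem_alternatingCircle {p : Plane} (hp : p ∈ E.Y) :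
    ∃ k, p ∈ E.alternatingCircle k := by
  rcases hp with hp | hp
  · obtain ⟨n, h⟩ := mem_iUnion.1 hp
    exact ⟨2 * n, by simpa [alternatingCircle] using h⟩
  · obtain ⟨q, hq, rfl⟩ := hp
    obtain ⟨n, h⟩ := mem_iUnion.1 hq
    refine ⟨2 * n + 1, ?_⟩
    rw [alternatingCircle, if_neg (by simp), show (2 * n + 1) / 2 = n by omega]
    exact ⟨q, h, rfl⟩

theorem a_mem_alternatingCircle (k : ℕ) : E.a ∈ E.alternatingCircle k := by
  rw [alternatingCircle_eq_sphere, mem_sphere_iff, chart_a]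
  simp

instance pathConnectedSpace_Y : PathConnectedSpace E.Y := by
  rw [← isPathConnected_iff_pathConnectedSpace]
  refine ⟨E.a, E.a_mem_Y, fun p hp => ?_⟩
  obtain ⟨k, hk⟩ := E.exists_mem_alternatingCircle hp
  exact ((E.isPathConnected_alternatingCircle k).joinedIn _ (E.a_mem_alternatingCircle k) _ hk).mono
    (E.alternatingCircle_subset_Y k)

instance pathConnectedSpace_X : PathConnectedSpace E.X := by
  rw [pathConnectedSpace_iff_univ]
  exact E.isShy_proj.2 univ (by rw [E.surjective_proj.range_eq]) isPathConnected_univ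

end HawaiianEarring
end

/-! ### Collapsing the small circles -/

noncomputable section

open scoped ComplexConjugate

/-- The map that is the identification of each circle through `0` with centre on the positive real
axis and radius more than `α` with the unit circle, and that collapses everything else to `1`. -/
def collapse (α : ℝ) (w : ℂ) : ℂ :=
  if 0 < w.re ∧ 2 * α * w.re < ‖w‖ ^ 2 then -w / conj w else 1

theorem collapse_of_re_nonpos {α : ℝ} {w : ℂ} (h : w.re ≤ 0) : collapse α w = 1 :=
  if_neg fun h' => h'.1.not_ge h

theorem norm_collapse (α : ℝ) (w : ℂ) : ‖collapse α w‖ = 1 := by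
  unfold collapse
  split_ifs with h
  · have : w ≠ 0 := by
      rintro rfl
      simp at h
    rw [norm_div, norm_neg, Complex.norm_conj, div_self (norm_ne_zero_iff.2 this)]
  · exact norm_one

/-- In the first case the left side is `2 Re w / ‖w‖`, and the condition `2α Re w < ‖w‖²` bounds it.
This gives continuity at `0`, where `-w / conj w` alone has no limit. -/
theorem norm_collapse_sub_one_le {α : ℝ} (hα : 0 < α) (w : ℂ) :
    ‖collapse α w - 1‖ ≤ ‖w‖ / α := by
  unfold collapse
  split_ifs with h
  · have hw : w ≠ 0 := by
      rintro rfl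
      simp at h
    have hn : 0 < ‖w‖ := norm_pos_iff.2 hw
    have hw' : conj w ≠ 0 := by simpa using hw
    have : -w / conj w - 1 = -((2 * w.re : ℝ) : ℂ) / conj w := by
      rw [← Complex.add_conj]
      field_simp
      ring
    rw [this, norm_div, norm_neg, Complex.norm_conj, Complex.norm_real, Real.norm_eq_abs,
      abs_of_pos (by linarith [h.1]), div_le_div_iff₀ hn hα]
    nlinarith [h.2]
  · simp only [sub_self, norm_zero]
    positivity

theorem continuousAt_collapse_zero {α : ℝ} (hα : 0 < α) : ContinuousAt (collapse α) 0 := by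
  have h0 : collapse α 0 = 1 := collapse_of_re_nonpos (by simp)
  rw [ContinuousAt, h0, tendsto_iff_norm_sub_tendsto_zero]
  refine squeeze_zero (fun _ => norm_nonneg _) (norm_collapse_sub_one_le hα) ?_
  have : Continuous fun w : ℂ => ‖w‖ / α := by fun_prop
  simpa using this.tendsto 0

/-- The two conditions exclude the borders between the branches. Across the circle of radius `α` the
function does jump, hence the choice of `α` strictly between consecutive radii. -/
theorem continuousAt_collapse {α : ℝ} {w : ℂ} (hre : w.re ≠ 0)
    (hα : 0 < w.re → ‖w‖ ^ 2 ≠ 2 * α * w.re) : ContinuousAt (collapse α) w := by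
  have hc : ContinuousAt Complex.re w := Complex.continuous_re.continuousAt
  have hn : ContinuousAt (fun w : ℂ => ‖w‖ ^ 2) w := by fun_prop
  have hc' : ContinuousAt (fun w : ℂ => 2 * α * w.re) w := hc.const_mul _
  have hone : (∀ᶠ v in 𝓝 w, collapse α v = 1) → ContinuousAt (collapse α) w := fun h =>
    continuousAt_const.congr (h.mono fun _ h => h.symm)
  rcases hre.lt_or_gt with h | h
  · refine hone ?_
    filter_upwards [hc.eventually_lt continuousAt_const h] with v hv
    exact collapse_of_re_nonpos hv.le
  · rcases (hα h).lt_or_gt with h' | h'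
    · refine hone ?_
      filter_upwards [hn.eventually_lt hc' h'] with v hv
      exact if_neg fun h'' => h''.2.not_gt hv
    · have hw : conj w ≠ 0 := fun h0 => by
        have := (map_eq_zero _).1 h0
        simp [this] at h
      have : ContinuousAt (fun w : ℂ => -w / conj w) w :=
        continuousAt_id.neg.div Complex.continuous_conj.continuousAt hw
      refine this.congr ?_
      filter_upwards [hc'.eventually_lt hn h', continuousAt_const.eventually_lt hc h] with v hv hv'
      exact (if_pos ⟨hv', hv⟩).symm

theorem re_one_sub_exp (φ : ℝ) : (1 - Complex.exp (φ * Complex.I)).re = 1 - Real.cos φ := by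
  rw [Complex.sub_re, Complex.exp_ofReal_mul_I_re, Complex.one_re]

theorem norm_sq_mul_one_sub_exp (ρ φ : ℝ) :
    ‖ρ * (1 - Complex.exp (φ * Complex.I))‖ ^ 2 =
      2 * ρ * (ρ * (1 - Complex.exp (φ * Complex.I))).re := by
  rw [Complex.re_ofReal_mul, re_one_sub_exp, norm_mul, mul_pow, Complex.norm_real,
    Real.norm_eq_abs, sq_abs, Complex.sq_norm, Complex.normSq_apply, re_one_sub_exp,
    Complex.sub_im, Complex.exp_ofReal_mul_I_im, Complex.one_im]
  linear_combination ρ ^ 2 * Real.sin_sq_add_cos_sq φ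

theorem collapse_circle_of_le {α ρ : ℝ} (h : ρ ≤ α) (φ : ℝ) :
    collapse α (ρ * (1 - Complex.exp (φ * Complex.I))) = 1 := by
  refine if_neg fun ⟨h1, h2⟩ => ?_
  rw [norm_sq_mul_one_sub_exp] at h2
  nlinarith

/-- For `|z| = 1` one has `conj z = 1 / z`, so `-w / conj w = z` when `w = ρ(1 - z)`; the radius
drops out. -/
theorem collapse_circle_of_lt {α ρ : ℝ} (hα : 0 < α) (h : α < ρ) (φ : ℝ) :
    collapse α (ρ * (1 - Complex.exp (φ * Complex.I))) = Complex.exp (φ * Complex.I) := by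
  have hρ : 0 < ρ := hα.trans h
  set z := Complex.exp (φ * Complex.I) with hz
  have hzz : z * conj z = 1 := by
    rw [Complex.mul_conj, Complex.normSq_eq_norm_sq, hz, Complex.norm_exp_ofReal_mul_I]
    simp
  by_cases h1 : z = 1
  · rw [h1, sub_self, mul_zero]
    exact collapse_of_re_nonpos (by simp)
  have hw : (ρ : ℂ) * (1 - z) ≠ 0 :=
    mul_ne_zero (by exact_mod_cast hρ.ne') (sub_ne_zero.2 (Ne.symm h1))
  have hnorm := norm_sq_mul_one_sub_exp ρ φ
  have hpos : 0 < ‖(ρ : ℂ) * (1 - z)‖ ^ 2 := by positivity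
  have hre : 0 < (ρ * (1 - z)).re := by
    rw [hnorm] at hpos
    exact pos_of_mul_pos_right hpos (by linarith)
  rw [collapse, if_pos ⟨hre, by rw [hnorm]; nlinarith⟩, div_eq_iff ((map_ne_zero _).2 hw)]
  simp only [map_mul, map_sub, map_one, Complex.conj_ofReal]
  linear_combination (ρ : ℂ) * hzz

namespace HawaiianEarring

variable (E : HawaiianEarring)

/-- A number between two consecutive radii. -/
def level (n : ℕ) : ℝ := (E.radius n + E.radius (n + 1)) / 2

theorem level_pos (n : ℕ) : 0 < E.level n := by
  have := E.radius_pos n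
  have := E.radius_pos (n + 1)
  unfold level
  linarith

theorem level_lt_radius {k n : ℕ} (h : k ≤ n) : E.level n < E.radius k := by
  have := E.radius_strictAnti.antitone h
  have := E.radius_strictAnti n.lt_succ_self
  unfold level
  linarith

theorem radius_lt_level {k n : ℕ} (h : n < k) : E.radius k < E.level n := by
  have := E.radius_strictAnti.antitone (Nat.succ_le_of_lt h)
  have := E.radius_strictAnti n.lt_succ_self
  unfold level
  linarith

theorem radius_ne_level (k n : ℕ) : E.radius k ≠ E.level n := by
  rcases le_or_gt k n with h | h
  · exact (E.level_lt_radius h).ne'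
  · exact (E.radius_lt_level h).ne

theorem exists_norm_sq_eq {p : Plane} (hp : p ∈ E.Y) :
    ∃ n, ‖E.chart p‖ ^ 2 = 2 * E.radius n * |(E.chart p).re| := by
  rcases hp with hp | hp
  · rw [abs_of_nonneg (E.re_nonneg_of_mem_H hp)]
    exact E.mem_H_iff.1 hp
  · rw [abs_of_nonpos (E.re_nonpos_of_mem_H' hp)]
    exact E.mem_H'_iff.1 hp

/-- No circle of `Y` has radius `level n`, so away from `a` the discontinuity is never met. The sign
`ε` selects the earring that survives. -/
theorem continuous_collapse_chart (n : ℕ) (ε : ℝ) (hε : |ε| = 1) :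
    Continuous fun y : E.Y => collapse (E.level n) (ε * E.chart y) := by
  refine continuous_iff_continuousAt.2 fun y => ?_
  have hchart : ContinuousAt (fun y : E.Y => (ε : ℂ) * E.chart y) y :=
    (continuous_const.mul (E.continuous_chart.comp continuous_subtype_val)).continuousAt
  suffices h : ContinuousAt (collapse (E.level n)) (ε * E.chart y) from
    ContinuousAt.comp (f := fun y : E.Y => (ε : ℂ) * E.chart y) h hchart
  by_cases hy : (E.chart y).re = 0
  · rw [E.eq_a_of_re_eq_zero y.2 hy, chart_a, mul_zero]
    exact continuousAt_collapse_zero (E.level_pos n)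
  have hε0 : ε ≠ 0 := fun h => by simp [h] at hε
  have hnorm : ‖(ε : ℂ) * E.chart y‖ = ‖E.chart y‖ := by
    rw [norm_mul, Complex.norm_real, Real.norm_eq_abs, hε, one_mul]
  refine continuousAt_collapse ?_ fun hpos => ?_
  · rw [Complex.re_ofReal_mul]
    exact mul_ne_zero hε0 hy
  · obtain ⟨k, hk⟩ := E.exists_norm_sq_eq y.2
    have habs : ((ε : ℂ) * E.chart y).re = |(E.chart y).re| := by
      rw [← abs_of_pos hpos, Complex.re_ofReal_mul, abs_mul, hε, one_mul]
    rw [hnorm, hk, habs]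
    intro h
    exact E.radius_ne_level k n (mul_left_cancel₀ two_ne_zero
      (mul_right_cancel₀ (abs_ne_zero.2 hy) h))

/-- The map from `Y` to the wedge of two circles that maps the circles `C₁, …, Cₙ₊₁` to one
circle, `C₁', …, Cₙ₊₁'` to the other, and collapses the smaller circles. -/
def toWedge (n : ℕ) : C(E.Y, WedgeOfCircles) where
  toFun y := ⟨fun b => collapse (E.level n) (((bif b then 1 else -1 : ℝ) : ℂ) * E.chart y),
    fun b => norm_collapse _ _, by
      rcases le_total 0 (E.chart y).re with h | h
      · exact ⟨false, collapse_of_re_nonpos (by simpa using h)⟩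
      · exact ⟨true, collapse_of_re_nonpos (by simpa using h)⟩⟩
  continuous_toFun := by
    refine Continuous.subtype_mk (continuous_pi fun b => E.continuous_collapse_chart n _ ?_) _
    cases b <;> simp

theorem toWedge_apply_true (n : ℕ) (y : E.Y) :
    (E.toWedge n y).1 true = collapse (E.level n) (E.chart y) := by
  simp [toWedge]

theorem toWedge_apply_false (n : ℕ) (y : E.Y) :
    (E.toWedge n y).1 false = collapse (E.level n) (-E.chart y) := by
  simp [toWedge]

theorem toWedge_a (n : ℕ) : (E.toWedge n ⟨E.a, E.a_mem_Y⟩).1 = 1 := by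
  funext b
  cases b
  · simp [toWedge_apply_false, chart_a, collapse_of_re_nonpos]
  · simp [toWedge_apply_true, chart_a, collapse_of_re_nonpos]

theorem toWedge_of_lt {n k : ℕ} (hk : k / 2 ≤ n) {y : E.Y} {φ : ℝ}
    (hy : E.chart y = E.signedRadius k * (1 - Complex.exp (φ * Complex.I))) :
    E.toWedge n y = WedgeOfCircles.circlePoint (PolySL.alternating k) φ := by
  have h1 := collapse_circle_of_lt (E.level_pos n) (E.level_lt_radius hk) φ
  -- In the other coordinate of the wedge the circle appears with negative radius, below every
  -- level, and is collapsed.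
  have h2 := collapse_circle_of_le (α := E.level n) (ρ := -E.radius (k / 2))
    (by linarith [E.level_pos n, E.radius_pos (k / 2)]) φ
  push_cast at h2
  rw [neg_mul] at h2
  refine Subtype.ext (funext fun b => ?_)
  by_cases hk : Even k
  · have hs : E.signedRadius k = E.radius (k / 2) := if_pos hk
    have hb : PolySL.alternating k = true := decide_eq_true hk
    rw [hs] at hy
    cases b
    · rw [toWedge_apply_false, hy, h2, hb]
      exact (WedgeOfCircles.circlePoint_apply_not true φ).symm
    · rw [toWedge_apply_true, hy, h1, hb, WedgeOfCircles.circlePoint_apply_self]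
  · have hs : E.signedRadius k = -E.radius (k / 2) := if_neg hk
    have hb : PolySL.alternating k = false := decide_eq_false hk
    rw [hs, Complex.ofReal_neg, neg_mul] at hy
    cases b
    · rw [toWedge_apply_false, hy, neg_neg, h1, hb, WedgeOfCircles.circlePoint_apply_self]
    · rw [toWedge_apply_true, hy, h2, hb]
      exact (WedgeOfCircles.circlePoint_apply_not false φ).symm

theorem toWedge_of_ge {n k : ℕ} (hk : n < k / 2) {y : E.Y} {φ : ℝ}
    (hy : E.chart y = E.signedRadius k * (1 - Complex.exp (φ * Complex.I))) :
    (E.toWedge n y).1 = 1 := by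
  have h0 : |E.signedRadius k| ≤ E.level n := by
    rw [abs_signedRadius]
    exact (E.radius_lt_level hk).le
  funext b
  cases b
  · rw [toWedge_apply_false, hy, ← neg_mul, ← Complex.ofReal_neg]
    exact collapse_circle_of_le ((neg_le_abs _).trans h0) φ
  · rw [toWedge_apply_true, hy]
    exact collapse_circle_of_le ((le_abs_self _).trans h0) φ

end HawaiianEarring
end

/-! ### Holonomy of alternating loops and of loops coming from `X` -/

noncomputable section

open scoped unitInterval
open WedgeOfCircles PolySL

/-- The path in the domain of a loop given by `t ↦ e ^ (2πit)`. -/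
def circlePath : C(I, Circle) where
  toFun t := Circle.exp (2 * Real.pi * t)
  continuous_toFun := by fun_prop

theorem circlePath_zero : circlePath 0 = 1 := by simp [circlePath]

theorem circlePath_one : circlePath 1 = 1 := by simp [circlePath]

namespace WedgeOfCircles

theorem transition_one {G : Type*} [Group G] (s : Bool → G) : transition s 1 = 1 := by
  simp [transition]

theorem hasHolonomy_const (w : WedgeOfCircles) {G : Type*} [Group G] [TopologicalSpace G]
    [DiscreteTopology G] (s : Bool → G) : HasHolonomy s (.const I w) 1 :=
  ⟨.const I (Cover.mk s w 1), fun _ => rfl, by simp⟩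

end WedgeOfCircles

namespace HawaiianEarring

variable (E : HawaiianEarring)

theorem signedRadius_ne_zero (k : ℕ) : E.signedRadius k ≠ 0 := by
  rw [← abs_pos, abs_signedRadius]
  exact E.radius_pos _

/-- The holonomy of a loop winding in alternation. -/
theorem hasHolonomy_of_windsInAlternation {m : ℕ → ℤ} {g : C(Circle, E.Y)}
    (hg : E.WindsInAlternation m g) (n : ℕ) :
    HasHolonomy generator ((E.toWedge n).comp (g.comp circlePath))
      (alternatingProduct m (2 * (n + 1))) := by
  obtain ⟨t, t_zero, t_mono, t_lim, ht⟩ := hg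
  obtain ⟨Γ, hΓ⟩ := exists_lift (s := generator) ((E.toWedge n).comp (g.comp circlePath))
  refine ⟨Γ, hΓ, ?_⟩
  have t_nonneg : ∀ k, 0 ≤ t k := fun k => t_zero ▸ t_mono.monotone (Nat.zero_le k)
  have t_lt : ∀ k, t k < 1 := fun k =>
    (t_mono k.lt_succ_self).trans_le (t_mono.monotone.ge_of_tendsto t_lim (k + 1))
  set Γ' : ℝ → Cover generator := fun x => Γ (projIcc 0 1 zero_le_one x) with hΓ'
  have hcont : Continuous Γ' := Γ.continuous.comp continuous_projIcc
  have hproj : ∀ x ∈ Icc (0 : ℝ) 1,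
      (Γ' x).1 = E.toWedge n (g (Circle.exp (2 * Real.pi * x))) := by
    intro x hx
    simp only [hΓ', hΓ, projIcc_of_mem zero_le_one hx]
    rfl
  have hwind : ∀ k, ∃ φ : ℝ → ℝ, ContinuousOn φ (Icc (t k) (t (k + 1))) ∧
      (∀ x ∈ Icc (t k) (t (k + 1)), E.chart (g (Circle.exp (2 * Real.pi * x))) =
        E.signedRadius k * (1 - Complex.exp (φ x * Complex.I))) ∧
      φ (t k) = 0 ∧ φ (t (k + 1)) = 2 * Real.pi * m k := by
    intro k
    obtain ⟨h1, h2⟩ := ht k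
    rw [alternatingCircle_eq_sphere] at h2
    exact (E.windsAround_iff (t_mono k.lt_succ_self).le h1 (E.signedRadius_ne_zero k)).1 h2
  have hsub : ∀ k, Icc (t k) (t (k + 1)) ⊆ Icc 0 1 := fun k =>
    Icc_subset_Icc (t_nonneg k) (t_lt _).le
  -- The circles met in the first `2(n + 1)` windings have index `k / 2 ≤ n`, so none of them is
  -- collapsed.
  have hstart : ∀ k ≤ 2 * (n + 1), Cover.coord (Γ' (t k)) =
      alternatingProduct m k * Cover.coord (Γ' 0) := by
    intro k hk
    induction k with
    | zero => rw [t_zero, alternatingProduct, one_mul]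
    | succ k ih =>
      obtain ⟨φ, hφ, hchart, h0, h1⟩ := hwind k
      rw [Cover.coord_of_winding (t_mono k.lt_succ_self).le hcont.continuousOn hφ
        (b := alternating k) (fun x hx => ?_) h0 h1, ih (by omega), alternatingProduct, mul_assoc]
      rw [hproj x (hsub k hx)]
      exact E.toWedge_of_lt (by omega) (hchart x hx)
  -- All later circles are collapsed. The endpoint `x = 1` lies in no winding interval, but there
  -- the loop is back at its starting point `a`.
  have htail : ∀ x ∈ Icc (t (2 * (n + 1))) 1,
      (E.toWedge n (g (Circle.exp (2 * Real.pi * x)))).1 = 1 := by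
    intro x hx
    rcases hx.2.eq_or_lt with rfl | hx1
    · have : g (Circle.exp (2 * Real.pi * 1)) = ⟨E.a, E.a_mem_Y⟩ := by
        apply Subtype.ext
        have := (ht 0).1
        simpa [t_zero] using this
      rw [this, toWedge_a]
    · have hex : ∃ k, x < t k := (t_lim.eventually_const_lt hx1).exists
      classical
      have hlt := Nat.find_spec hex
      have hmin := fun k => Nat.find_min hex (m := k)
      set K := Nat.find hex
      have hK : 2 * (n + 1) < K := t_mono.lt_iff_lt.1 (hx.1.trans_lt hlt)
      obtain ⟨k, hk⟩ : ∃ k, K = k + 1 := ⟨K - 1, by omega⟩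
      rw [hk] at hlt
      obtain ⟨φ, -, hchart, -⟩ := hwind k
      exact E.toWedge_of_ge (by omega)
        (hchart x ⟨not_lt.1 (hmin k (by omega)), hlt.le⟩)
  -- All transition values are trivial on the tail, so the fibre coordinate stays in one coset of
  -- the trivial subgroup.
  have hend : Cover.coord (Γ' 1) * (Cover.coord (Γ' (t (2 * (n + 1)))))⁻¹ ∈
      (⊥ : Subgroup PolySL) := by
    refine Cover.coord_mul_inv_mem (isPreconnected_Icc (a := t (2 * (n + 1))) (b := 1))
      hcont.continuousOn (fun x hx => ?_) (left_mem_Icc.2 (t_lt _).le)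
      (right_mem_Icc.2 (t_lt _).le)
    rw [hproj x ⟨(t_nonneg _).trans hx.1, hx.2⟩, htail x hx, transition_one]
    exact Subgroup.mem_bot.2 rfl
  rw [Subgroup.mem_bot, mul_inv_eq_one, hstart _ le_rfl] at hend
  simpa [hΓ'] using hend

/-- Below height `1` there are only `H × {0}` and points of the segment, all projecting into `H`. -/
theorem toWedge_proj_of_snd_lt {n : ℕ} {x : E.X} (h : x.1.2 < 1) :
    (E.toWedge n (E.proj x)).1 (!true) = 1 := by
  have : 0 ≤ (E.chart (E.proj x)).re := by
    refine E.re_nonneg_of_mem_H ?_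
    rcases x.2 with (⟨h1, -⟩ | ⟨-, h2⟩) | ⟨h1, -⟩
    · exact h1
    · exact absurd h2 h.ne
    · rw [show (E.proj x).1 = E.a from h1]
      exact E.a_mem_H
  exact (E.toWedge_apply_false n _).trans (collapse_of_re_nonpos (by simpa using this))

theorem toWedge_proj_of_snd_pos {n : ℕ} {x : E.X} (h : 0 < x.1.2) :
    (E.toWedge n (E.proj x)).1 (!false) = 1 := by
  have : (E.chart (E.proj x)).re ≤ 0 := by
    refine E.re_nonpos_of_mem_H' ?_
    rcases x.2 with (⟨-, h2⟩ | ⟨h1, -⟩) | ⟨h1, -⟩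
    · exact absurd h2 h.ne'
    · exact h1
    · rw [show (E.proj x).1 = E.a from h1]
      exact E.a_mem_H'
  exact (E.toWedge_apply_true n _).trans (collapse_of_re_nonpos this)

/-- The holonomy of the projection of a loop in `X` has a degree bound independent of the number
of circles taken into account. -/
theorem exists_degreeLE_hasHolonomy (l : C(I, E.X)) :
    ∃ K, ∀ n, ∃ M, DegreeLE K M ∧
      HasHolonomy generator ((E.toWedge n).comp (E.proj.comp l)) M := by
  have hheight : Continuous fun t : I => (l t).1.2 := by fun_prop
  set c : Bool → Set I := fun b => bif b then {t | (l t).1.2 < 1} else {t | 0 < (l t).1.2} with hc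
  -- A Lebesgue subdivision: on each piece the loop stays below height `1` or above height `0`. It
  -- is chosen before `n`, so `K` depends on `l` alone.
  obtain ⟨t, t_zero, t_mono, ⟨K, hK⟩, ht⟩ := exists_monotone_Icc_subset_open_cover_unitInterval
    (c := c) (by
      rintro (_ | _)
      · exact isOpen_lt continuous_const hheight
      · exact isOpen_lt hheight continuous_const) (fun x _ => by
      rw [mem_iUnion]
      rcases lt_or_ge (l x).1.2 1 with h | h
      · exact ⟨true, h⟩
      · exact ⟨false, zero_lt_one.trans_le h⟩)
  refine ⟨K, fun n => ?_⟩
  obtain ⟨Γ, hΓ⟩ := exists_lift (s := generator) ((E.toWedge n).comp (E.proj.comp l))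
  have step : ∀ k, DegreeLE k (Cover.coord (Γ (t k)) * (Cover.coord (Γ (t 0)))⁻¹) := by
    intro k
    induction k with
    | zero =>
      rw [mul_inv_cancel]
      exact degreeLE_one
    | succ k ih =>
      obtain ⟨b, hb⟩ := ht k
      have htk := t_mono k.le_succ
      -- The image of a piece stays in one circle of the wedge, so its holonomy is a power of one
      -- generator and costs at most one degree.
      have hmem := Cover.coord_mul_inv_mem (isPreconnected_Icc (a := t k) (b := t (k + 1)))
        Γ.continuous.continuousOn (A := Subgroup.zpowers (generator b)) (fun x hx => by
          have haxis : ((Γ x).1).1 (!b) = 1 := by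
            rw [hΓ]
            have := hb hx
            cases b
            · exact E.toWedge_proj_of_snd_pos this
            · exact E.toWedge_proj_of_snd_lt this
          rw [transition_of_axis _ haxis]
          split_ifs
          · exact inv_mem (Subgroup.mem_zpowers _)
          · exact one_mem _)
        (left_mem_Icc.2 htk) (right_mem_Icc.2 htk)
      have := (degreeLE_of_mem_zpowers hmem).mul ih
      rw [← mul_assoc, inv_mul_cancel_right, add_comm] at this
      exact this
  refine ⟨_, step K, Γ, hΓ, ?_⟩
  rw [hK K le_rfl, t_zero, inv_mul_cancel_right]

/-- For `n = K` the conjugate holonomies would have a common trace of degree at most `K` and at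
least `2(K + 1)`. The homotopy is given on a square with matching sides so as to cover both free and
based homotopies. -/
theorem not_homotopic_of_windsInAlternation {m : ℕ → ℤ} (hm : ∀ k, m k ≠ 0) {g : C(Circle, E.Y)}
    (hg : E.WindsInAlternation m g) (l : C(I, E.X))
    (h : C(I × I, E.Y)) (hloop : ∀ r, h (r, 0) = h (r, 1)) (h₀ : ∀ t, h (0, t) = E.proj (l t))
    (h₁ : ∀ t, h (1, t) = g (circlePath t)) : False := by
  obtain ⟨K, hK⟩ := E.exists_degreeLE_hasHolonomy l
  obtain ⟨M, hM, hM'⟩ := hK K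
  have hconj := hM'.isConj_of_homotopy (h := (E.toWedge K).comp h)
    (γ₀ := (E.toWedge K).comp (E.proj.comp l)) (γ₁ := (E.toWedge K).comp (g.comp circlePath))
    (fun r => congrArg (E.toWedge K) (hloop r)) (fun t => congrArg (E.toWedge K) (h₀ t))
    (fun t => congrArg (E.toWedge K) (h₁ t)) (E.hasHolonomy_of_windsInAlternation hg K)
  have h1 := le_natDegree_trace_alternatingProduct hm K
  rw [← trace_eq_of_isConj hconj] at h1
  have := hM.trace
  omega

theorem not_homotopic_comp_proj {m : ℕ → ℤ} (hm : ∀ k, m k ≠ 0) {g : C(Circle, E.Y)}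
    (hg : E.WindsInAlternation m g) : ¬ ∃ l : C(Circle, E.X), (E.proj.comp l).Homotopic g := by
  rintro ⟨l, ⟨F⟩⟩
  refine E.not_homotopic_of_windsInAlternation hm hg (l.comp circlePath)
    (F.toContinuousMap.comp ((ContinuousMap.id I).prodMap circlePath)) (fun r => ?_)
    (fun t => ?_) (fun t => ?_)
  · simp [circlePath_zero, circlePath_one]
  · simp
  · simp

-- The loop `g` is based at `a` and `x₀` is arbitrary, so its class is transported along a path from
-- `x₀` to a point over `a`. A preimage at `x₀`, transported back, would be a loop in `X` projecting
-- to the class of `g`.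
open CategoryTheory in
theorem not_surjective_map {m : ℕ → ℤ} (hm : ∀ k, m k ≠ 0) {g : C(Circle, E.Y)}
    (hg : E.WindsInAlternation m g) (x₀ : E.X) :
    ¬ Function.Surjective (FundamentalGroup.map E.proj x₀) := by
  intro hsurj
  have hg0 : g 1 = ⟨E.a, E.a_mem_Y⟩ := by
    obtain ⟨t, t_zero, -, -, ht⟩ := hg
    apply Subtype.ext
    simpa [t_zero] using (ht 0).1
  set x₁ : E.X := E.segmentMap 0
  have hx₁ : E.proj x₁ = ⟨E.a, E.a_mem_Y⟩ := E.proj_segmentMap 0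
  let γ : Path (E.proj x₁) (E.proj x₁) :=
    { toContinuousMap := g.comp circlePath
      source' := by simp [circlePath_zero, hg0, hx₁]
      target' := by simp [circlePath_one, hg0, hx₁] }
  obtain ⟨δ⟩ := PathConnectedSpace.joined x₀ x₁
  let D : FundamentalGroupoid.mk x₀ ⟶ FundamentalGroupoid.mk x₁ := ⟦δ⟧
  let F : FundamentalGroupoid E.X ⥤ FundamentalGroupoid E.Y := FundamentalGroupoid.map E.proj
  let c : F.obj ⟨x₁⟩ ⟶ F.obj ⟨x₁⟩ := ⟦γ⟧
  obtain ⟨l, hl⟩ := hsurj (F.map D ≫ c ≫ F.map (inv D))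
  have hl' : F.map l = F.map D ≫ c ≫ F.map (inv D) := hl
  have hc : F.map (inv D ≫ l ≫ D) = c := by
    rw [Functor.map_comp, Functor.map_comp, hl', Category.assoc, Category.assoc, ← F.map_comp,
      IsIso.inv_hom_id, F.map_id, Category.comp_id, ← Category.assoc, ← F.map_comp, IsIso.inv_hom_id, F.map_id,
      Category.id_comp]
  obtain ⟨q, hq⟩ := Quotient.exists_rep
    (show Path.Homotopic.Quotient x₁ x₁ from inv D ≫ l ≫ D)
  have hq' : F.map (show FundamentalGroupoid.mk x₁ ⟶ FundamentalGroupoid.mk x₁ from ⟦q⟧) = c := by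
    rw [← hc]
    exact congrArg _ hq
  obtain ⟨P⟩ : Path.Homotopic (q.map E.proj.continuous) γ := Quotient.exact hq'
  exact E.not_homotopic_of_windsInAlternation hm hg q.toContinuousMap P.toContinuousMap
    (fun r => (P.source r).trans (P.target r).symm) P.apply_zero P.apply_one

end HawaiianEarring
end

/-! ### Existence of alternating loops; small essential circles -/

noncomputable section

open scoped unitInterval
open WedgeOfCircles PolySL

theorem circlePath_surjective : Function.Surjective circlePath := by
  intro z
  have hpi := Real.pi_pos
  obtain ⟨θ, hθ, rfl⟩ : ∃ θ ∈ Ico (0 : ℝ) (2 * Real.pi), Circle.exp θ = z := by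
    obtain ⟨θ, rfl⟩ := Circle.exp_surjective z
    have := Circle.periodic_exp.exists_mem_Ico₀ Real.two_pi_pos θ
    obtain ⟨y, hy, h⟩ := this
    exact ⟨y, hy, h.symm⟩
  refine ⟨⟨θ / (2 * Real.pi), div_nonneg hθ.1 (by positivity),
    (div_le_one (by positivity)).2 hθ.2.le⟩, ?_⟩
  simp only [circlePath, ContinuousMap.coe_mk]
  rw [mul_div_cancel₀ _ (by positivity)]

/-- A continuous surjection from a compact space to a Hausdorff space is a quotient map, and
`circlePath` identifies only the two endpoints. -/
theorem exists_circle_factorization {Z : Type*} [TopologicalSpace Z] (f : C(I, Z))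
    (hf : f 0 = f 1) : ∃ g : C(Circle, Z), ∀ t, g (circlePath t) = f t := by
  have hq : IsQuotientMap circlePath :=
    circlePath.continuous.isClosedMap.isQuotientMap circlePath.continuous circlePath_surjective
  have hfac : ∀ s t : I, s ≤ t → circlePath s = circlePath t → f s = f t := by
    intro s t hst h
    obtain ⟨m, hm⟩ := Circle.exp_eq_exp.1 h
    have hm' : (s : ℝ) = t + m := by
      have : 2 * Real.pi * (s : ℝ) = 2 * Real.pi * (t + m) := by linarith
      exact mul_left_cancel₀ Real.two_pi_pos.ne' this
    rcases eq_or_ne m 0 with rfl | h0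
    · rw [show s = t from Subtype.ext (by simpa using hm')]
    · have h1 : (m : ℝ) ≤ 0 := by linarith [show (s : ℝ) ≤ t from hst]
      have h2 : m ≤ -1 := by
        have : m ≤ 0 := by exact_mod_cast h1
        omega
      have h3 : (m : ℝ) ≤ -1 := by exact_mod_cast h2
      rw [show s = 0 from Subtype.ext (by linarith [s.2.1, t.2.2] : (s : ℝ) = 0),
        show t = 1 from Subtype.ext (by linarith [s.2.1, t.2.2] : (t : ℝ) = 1), hf]
  have hfac' : Function.FactorsThrough f circlePath := fun s t h =>
    (le_total s t).elim (fun hst => hfac s t hst h) fun hst => (hfac t s hst h.symm).symm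
  exact ⟨hq.lift f hfac', fun t => DFunLike.congr_fun (hq.lift_comp f hfac') t⟩

namespace HawaiianEarring

variable (E : HawaiianEarring)

/-- The times at which the loop constructed below passes from one circle to the next. -/
def switchTime (k : ℕ) : ℝ := 1 - (1 / 2) ^ k

theorem switchTime_strictMono : StrictMono switchTime := by
  refine strictMono_nat_of_lt_succ fun k => ?_
  have : (0 : ℝ) < (1 / 2) ^ k := by positivity
  rw [switchTime, switchTime, pow_succ]
  linarith

theorem switchTime_tendsto : Tendsto switchTime atTop (𝓝 1) := by
  have := (tendsto_pow_atTop_nhds_zero_of_lt_one (r := (1 / 2 : ℝ)) (by norm_num)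
    (by norm_num)).const_sub 1
  rwa [sub_zero] at this

theorem switchTime_lt_one (k : ℕ) : switchTime k < 1 := by
  have : (0 : ℝ) < (1 / 2) ^ k := by positivity
  rw [switchTime]
  linarith

/-- The angle of the `k`-th winding. -/
def windingAngle (m : ℕ → ℤ) (k : ℕ) (x : ℝ) : ℝ :=
  2 * Real.pi * m k * max 0 (min 1 ((x - switchTime k) / (switchTime (k + 1) - switchTime k)))

theorem continuous_windingAngle (m : ℕ → ℤ) (k : ℕ) : Continuous (windingAngle m k) := by
  unfold windingAngle
  fun_prop

theorem windingAngle_of_le (m : ℕ → ℤ) {k : ℕ} {x : ℝ} (h : x ≤ switchTime k) :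
    windingAngle m k x = 0 := by
  have hk := switchTime_strictMono k.lt_succ_self
  have : (x - switchTime k) / (switchTime (k + 1) - switchTime k) ≤ 0 :=
    div_nonpos_of_nonpos_of_nonneg (by linarith) (sub_nonneg.2 hk.le)
  rw [windingAngle, max_eq_left ((min_le_right _ _).trans this), mul_zero]

theorem windingAngle_of_ge (m : ℕ → ℤ) {k : ℕ} {x : ℝ} (h : switchTime (k + 1) ≤ x) :
    windingAngle m k x = 2 * Real.pi * m k := by
  have hk := switchTime_strictMono k.lt_succ_self
  have : 1 ≤ (x - switchTime k) / (switchTime (k + 1) - switchTime k) :=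
    (one_le_div (sub_pos.2 hk)).2 (by linarith)
  rw [windingAngle, min_eq_left this, max_eq_right zero_le_one, mul_one]

/-- The `k`-th winding in the complex coordinate, resting at `0` before and after. -/
def winding (m : ℕ → ℤ) (k : ℕ) (x : ℝ) : ℂ :=
  E.signedRadius k * (1 - Complex.exp (windingAngle m k x * Complex.I))

theorem continuous_winding (m : ℕ → ℤ) (k : ℕ) : Continuous (E.winding m k) := by
  have := continuous_windingAngle m k
  unfold winding
  fun_prop

theorem winding_of_notMem (m : ℕ → ℤ) {k : ℕ} {x : ℝ}
    (h : x ∉ Ioo (switchTime k) (switchTime (k + 1))) : E.winding m k x = 0 := by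
  rcases le_or_gt x (switchTime k) with h' | h'
  · simp [winding, windingAngle_of_le m h']
  · rw [winding, windingAngle_of_ge m (not_lt.1 fun h'' => h ⟨h', h''⟩)]
    push_cast
    rw [mul_comm (2 * (Real.pi : ℂ)), mul_assoc, Complex.exp_int_mul_two_pi_mul_I, sub_self,
      mul_zero]

theorem norm_winding_le (m : ℕ → ℤ) (k : ℕ) (x : ℝ) :
    ‖E.winding m k x‖ ≤ 2 * E.radius (k / 2) := by
  rw [winding, norm_mul, Complex.norm_real, Real.norm_eq_abs, abs_signedRadius, mul_comm]
  refine mul_le_mul_of_nonneg_right ?_ (E.radius_pos _).le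
  refine (norm_sub_le _ _).trans ?_
  rw [Complex.norm_exp_ofReal_mul_I, norm_one]
  norm_num

theorem winding_eq_zero_of_ne (m : ℕ → ℤ) {j k : ℕ} (hjk : j ≠ k) {x : ℝ}
    (hx : x ∈ Icc (switchTime k) (switchTime (k + 1))) : E.winding m j x = 0 := by
  refine E.winding_of_notMem m fun hj => ?_
  have h1 := switchTime_strictMono.lt_iff_lt.1 (hj.1.trans_le hx.2)
  have h2 := switchTime_strictMono.lt_iff_lt.1 (hx.1.trans_lt hj.2)
  omega

theorem exists_forall_ne_winding_eq_zero (m : ℕ → ℤ) (x : ℝ) :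
    ∃ k, ∀ j ≠ k, E.winding m j x = 0 := by
  by_cases h : ∃ k, x ∈ Ioo (switchTime k) (switchTime (k + 1))
  · obtain ⟨k, hk⟩ := h
    exact ⟨k, fun j hj => E.winding_eq_zero_of_ne m hj (Ioo_subset_Icc_self hk)⟩
  · exact ⟨0, fun j _ => E.winding_of_notMem m fun hj => h ⟨j, hj⟩⟩

/-- The concatenation of all windings. -/
def windings (m : ℕ → ℤ) (x : ℝ) : ℂ := ∑' k, E.winding m k x

theorem windings_eq (m : ℕ → ℤ) {x : ℝ} {k : ℕ} (h : ∀ j ≠ k, E.winding m j x = 0) :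
    E.windings m x = E.winding m k x :=
  tsum_eq_single k h

/-- At each time at most one winding is nonzero, so the error of a partial sum is at most the
diameter of one omitted circle, and convergence is uniform. -/
theorem continuous_windings (m : ℕ → ℤ) : Continuous (E.windings m) := by
  have hlim : TendstoUniformly (fun n x => ∑ k ∈ Finset.range n, E.winding m k x)
      (E.windings m) atTop := by
    rw [Metric.tendstoUniformly_iff]
    intro ε hε
    obtain ⟨N, hN⟩ := (E.radius_tendsto.eventually_lt_const (half_pos hε)).exists
    -- The factor `2` appears because the `k`-th circle has radius index `k / 2`.
    filter_upwards [eventually_ge_atTop (2 * N)] with n hn x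
    obtain ⟨k, hk⟩ := E.exists_forall_ne_winding_eq_zero m x
    rw [E.windings_eq m hk]
    rcases lt_or_ge k n with h | h
    · rw [Finset.sum_eq_single_of_mem k (Finset.mem_range.2 h) fun j _ hj => hk j hj, dist_self]
      exact hε
    · rw [Finset.sum_eq_zero fun j hj => hk j (by have := Finset.mem_range.1 hj; omega),
        dist_zero_right]
      have h1 := E.norm_winding_le m k x
      have h2 := E.radius_strictAnti.antitone (show N ≤ k / 2 by omega)
      linarith
  exact hlim.continuous (Frequently.of_forall fun n =>
    continuous_finsetSum _ fun k _ => E.continuous_winding m k)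

theorem point_mem_alternatingCircle (k : ℕ) (φ : ℝ) :
    E.point (E.signedRadius k * (1 - Complex.exp (φ * Complex.I))) ∈ E.alternatingCircle k := by
  rw [alternatingCircle_eq_sphere, mem_sphere_iff, chart_point, norm_sub_ofReal_eq_abs_iff]
  exact norm_sq_mul_one_sub_exp _ _

theorem exists_windsInAlternation (m : ℕ → ℤ) :
    ∃ g : C(Circle, E.Y), E.WindsInAlternation m g := by
  have hmem : ∀ x, E.point (E.windings m x) ∈ E.Y := by
    intro x
    obtain ⟨k, hk⟩ := E.exists_forall_ne_winding_eq_zero m x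
    rw [E.windings_eq m hk]
    exact E.alternatingCircle_subset_Y k (E.point_mem_alternatingCircle k _)
  let f : C(I, E.Y) := ⟨fun t => ⟨E.point (E.windings m t), hmem t⟩,
    (E.continuous_point.comp ((E.continuous_windings m).comp continuous_subtype_val)).subtype_mk _⟩
  have hzero : ∀ x, (∀ k, x ∉ Ioo (switchTime k) (switchTime (k + 1))) → E.windings m x = 0 :=
    fun x hx => (E.windings_eq m (k := 0) fun j _ => E.winding_of_notMem m (hx j)).trans
      (E.winding_of_notMem m (hx 0))
  have h0 : switchTime 0 = 0 := by simp [switchTime]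
  have hnonneg : ∀ k, 0 ≤ switchTime k := fun k =>
    h0 ▸ switchTime_strictMono.monotone (Nat.zero_le k)
  -- No winding is active at times `0` and `1`, so both ends are at `a`.
  obtain ⟨g, hg⟩ := exists_circle_factorization f (Subtype.ext (congrArg E.point (by
    rw [hzero _ fun k hk => (hnonneg k).not_gt (by simpa using hk.1),
      hzero _ fun k hk => (switchTime_lt_one (k + 1)).not_gt (by simpa using hk.2)])))
  have hg' : ∀ x ∈ Icc (0 : ℝ) 1, (g (Circle.exp (2 * Real.pi * x)) : Plane) =
      E.point (E.windings m x) := fun x hx => congrArg Subtype.val (hg ⟨x, hx⟩)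
  have hk : ∀ k, switchTime k ≤ switchTime (k + 1) := fun k =>
    (switchTime_strictMono k.lt_succ_self).le
  have hval : ∀ k, ∀ x ∈ Icc (switchTime k) (switchTime (k + 1)),
      (g (Circle.exp (2 * Real.pi * x)) : Plane) = E.point (E.winding m k x) := by
    intro k x hx
    rw [hg' x ⟨(hnonneg k).trans hx.1, hx.2.trans (switchTime_lt_one _).le⟩,
      E.windings_eq m fun j hj => E.winding_eq_zero_of_ne m hj hx]
  have ha : ∀ k, (g (Circle.exp (2 * Real.pi * switchTime k)) : Plane) = E.a := by
    intro k
    rw [hval k _ (left_mem_Icc.2 (hk k)), E.winding_of_notMem m (fun h => lt_irrefl _ h.1),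
      point_zero]
  refine ⟨g, switchTime, h0, switchTime_strictMono, switchTime_tendsto, fun k => ⟨ha k, ?_⟩⟩
  rw [alternatingCircle_eq_sphere, windsAround_iff _ (hk k) (ha k) (E.signedRadius_ne_zero k)]
  refine ⟨windingAngle m k, (continuous_windingAngle m k).continuousOn, fun x hx => ?_,
    windingAngle_of_le m le_rfl, windingAngle_of_ge m le_rfl⟩
  rw [hval k x hx, chart_point, winding]

theorem norm_point_sub (w : ℂ) : ‖E.point w - E.a‖ = ‖w‖ := by
  rw [point, add_sub_cancel_left, LinearIsometryEquiv.norm_map, norm_mul, norm_direction, mul_one]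

/-- Every neighbourhood of `a` contains a circle of `H`. With the level just below its radius, its
holonomy is a generator, which is not conjugate to the trivial holonomy of a constant loop. -/
theorem not_isSemilocallySimplyConnected_Y : ¬ IsSemilocallySimplyConnected E.Y := by
  intro h
  obtain ⟨N, hN, hloop⟩ := h ⟨E.a, E.a_mem_Y⟩
  obtain ⟨ε, hε, hball⟩ := Metric.mem_nhds_iff.1 hN
  obtain ⟨n, hn⟩ := (E.radius_tendsto.eventually_lt_const (half_pos hε)).exists
  have hs : E.signedRadius (2 * n) = E.radius n := by simp [signedRadius]
  have hpoint : ∀ z : Circle, ∃ φ : ℝ, (z : ℂ) = Complex.exp (φ * Complex.I) := fun z => by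
    obtain ⟨φ, rfl⟩ := Circle.exp_surjective z
    exact ⟨φ, Circle.coe_exp φ⟩
  let g : C(Circle, E.Y) :=
    { toFun := fun z => ⟨E.point (E.radius n * (1 - z)), by
        obtain ⟨φ, hφ⟩ := hpoint z
        rw [hφ, ← hs]
        exact E.alternatingCircle_subset_Y _ (E.point_mem_alternatingCircle _ φ)⟩
      continuous_toFun := by
        refine Continuous.subtype_mk (E.continuous_point.comp ?_) _
        fun_prop }
  obtain ⟨y, ⟨F⟩⟩ := hloop g fun z => hball (by
    rw [Metric.mem_ball, Subtype.dist_eq, dist_eq_norm]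
    change ‖E.point (E.radius n * (1 - z)) - E.a‖ < ε
    rw [norm_point_sub, norm_mul, Complex.norm_real, Real.norm_eq_abs,
      abs_of_pos (E.radius_pos n)]
    have : ‖(1 - z : ℂ)‖ ≤ 2 := (norm_sub_le _ _).trans
      (by rw [norm_one, Circle.norm_coe]; norm_num)
    nlinarith [E.radius_pos n])
  have hol : HasHolonomy generator ((E.toWedge n).comp (g.comp circlePath)) (generator true) := by
    obtain ⟨Γ, hΓ⟩ := exists_lift (s := generator) ((E.toWedge n).comp (g.comp circlePath))
    refine ⟨Γ, hΓ, ?_⟩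
    have := Cover.coord_of_winding (Γ := fun x => Γ (projIcc 0 1 zero_le_one x))
      (φ := fun x => 2 * Real.pi * x) (u := 0) (v := 1) (b := true) (m := 1) zero_le_one
      (Γ.continuous.comp continuous_projIcc).continuousOn (by fun_prop) (fun x hx => by
        rw [hΓ, projIcc_of_mem zero_le_one hx]
        have hb : alternating (2 * n) = true := by simp [alternating]
        rw [← hb]
        refine E.toWedge_of_lt (by omega) ?_
        change E.chart (E.point _) = _
        rw [chart_point, hs]
        simp [circlePath]) (by simp) (by simp)
    simpa using this
  have hconj := hol.isConj_of_homotopy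
    (h := (E.toWedge n).comp (F.toContinuousMap.comp ((ContinuousMap.id I).prodMap circlePath)))
    (γ₁ := .const I (E.toWedge n y)) (by simp [circlePath_zero, circlePath_one]) (by simp)
    (by simp) (hasHolonomy_const _ _)
  exact generator_ne_one true (isConj_one_left.1 hconj)

end HawaiianEarring
end

theorem mainTheorem8 (E : HawaiianEarring) :
    E.H ∩ E.H' = {E.a} ∧
    IsShy E.proj ∧
    Function.Surjective E.proj ∧
    (∀ x₀ : E.X, ¬ Function.Surjective (FundamentalGroup.map E.proj x₀)) ∧
    (∀ m : ℕ → ℤ, (∀ k, m k ≠ 0) →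
      (∃ g : C(Circle, E.Y), E.WindsInAlternation m g) ∧
      ∀ g : C(Circle, E.Y), E.WindsInAlternation m g →
        ¬ ∃ l : C(Circle, E.X), (E.proj.comp l).Homotopic g) ∧
    ¬ IsSemilocallySimplyConnected E.Y := by
  refine ⟨E.H_inter_H', E.isShy_proj, E.surjective_proj, fun x₀ => ?_,
    fun m hm => ⟨E.exists_windsInAlternation m, fun g hg => E.not_homotopic_comp_proj hm hg⟩,
    E.not_isSemilocallySimplyConnected_Y⟩
  obtain ⟨g, hg⟩ := E.exists_windsInAlternation fun _ => 1
  exact E.not_surjective_map (fun _ => one_ne_zero) hg x₀
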